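/- Let $\mathfrak{sl}(2)$ be the real Lie algebra with basis $X_1,X_2,X_3$ and brackets $[X_1,X_2]=-X_3$, $[X_3,X_1]=X_2$, $[X_3,X_2]=-X_1$; let $x_1,x_2,x_3$ be the corresponding coordinates on $\mathfrak{sl}(2)^*\cong\mathbb R^3$, and let $\Omega=\mathfrak{sl}(2)^*\setminus\{0\}$ carry its linear Poisson bivector $\Lambda$, $\Lambda(dx_i,dx_j)(x)=\langle x,[X_i,X_j]\rangle$ (of constant rank $2$). For $f\in C^\infty(\Omega)$ write $H_f=\{f,\cdot\}$, and let $I(\Omega)$ be the algebra of Casimir functions (those $f$ with $H_f=0$). Let $\sigma=[\Lambda,\cdot]$ (Schouten bracket). The P-cohomology $H^k_\Lambda(\Omega)$ is the cohomology of $\sigma$ on smooth multivector fields on $\Omega$; the TP-cohomology $H^k_{\Lambda,tan}(\Omega)$ is the cohomology of $\sigma$ on smooth multivector fields tangent to the symplectic leaves. Both are modules over $\mathbb R$, over the ring $S(\mathfrak g)^G$ of $G$-invariant polynomial functions on $\mathfrak{sl}(2)^*$, and over the ring $\mathcal A(\mathfrak g)^G$ of $G$-invariant real-analytic functions on $\mathfrak{sl}(2)^*$,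 where $G$ is the connected and simply connected Lie group with Lie algebra $\mathfrak g=\mathfrak{sl}(2)$. Call such a space *infinite dimensional* if it is infinite dimensional over $\mathbb R$ and finitely generated neither over $S(\mathfrak g)^G$ nor over $\mathcal A(\mathfrak g)^G$. On $U=\{x_1^2+x_2^2-x_3^2>0\}$ use the parameters $(p,q,z)$, $z>0$, with $$x_1=-p\sin q+z\cos q,\quad x_2=-p\cos q-z\sin q,\quad x_3=p .$$ For $\alpha>\tfrac12$ put $$\hat t_\alpha=\frac1{(x_1^2+x_2^2+x_3^2)^{\alpha}},\qquad \hat k_\alpha=\frac{\exp\!\big(\frac{\alpha}{x_1^2+x_2^2+x_3^2}\big)}{(x_1^2+x_2^2+x_3^2)^2}.$$ Then: 1. $H^0_{\Lambda,tan}(\Omega)\cong I(\Omega)$, and $H^k_{\Lambda,tan}(\Omega)=0$ for all $k>2$. 2. (Limit obstructions.) (a) If $a,f\in C^\infty(\Omega)$ and $aH_{x_3}=\sigma f$, then for every $q$ the limit $\lim_{z\to0^+}\int_{-1}^1 a(s,q,z)\,ds$ exists in $\mathbb R$. (b) If $\varphi\in C^\infty(\Omega)$ is such that $\varphi|_U$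 depends only on $(p,z)$, and $\varphi\Lambda=\sigma(B)$ for some smooth tangential vector field $B$ on $\Omega$, then $\lim_{z\to0^+}\int_{-1}^1 2\pi\varphi(s,z)\,ds$ exists in $\mathbb R$. 3. (Degree 1.) For $\alpha>\frac12$, $\hat t_\alpha H_{x_3}$ and $\hat k_\alpha H_{x_3}$ are tangential $\sigma$-cocycles. The classes $[\hat t_\alpha H_{x_3}]$, $\alpha>\frac12$, in $H^1_{\Lambda,tan}(\Omega)$ are linearly independent over $\mathbb R$, and the classes $[\hat k_\alpha H_{x_3}]$, $\alpha>\frac12$, are linearly independent over $\mathbb R$, over $S(\mathfrak g)^G$ and over $\mathcal A(\mathfrak g)^G$. 4. (Degree 2.) For $\alpha>\frac12$, $\hat t_\alpha\Lambda$ and $\hat k_\alpha\Lambda$ are tangential $\sigma$-cocycles. The classes $[\hat t_\alpha\Lambda]$, $\alpha>\frac12$, in $H^2_{\Lambda,tan}(\Omega)$ are linearly independent over $\mathbb R$, and the classes $[\hat k_\alpha\Lambda]$, $\alpha>\frac12$, are linearly independent over $\mathbb R$, over $S(\mathfrak g)^G$ and over $\mathcal A(\mathfrak g)^G$. 5. $H^1_{\Lambda,tan}(\Omega)$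 and $H^2_{\Lambda,tan}(\Omega)$ are infinite dimensional. 6. $H^k_\Lambda(\Omega)$ is infinite dimensional for $1\le k\le3$. -/

import Mathlib

open scoped ContDiff Topology

noncomputable section

namespace PoissonTP

/-! ### Multivector fields on an open set of `ℝⁿ` -/

/-- `k`-vectors of `ℝⁿ`, seen as alternating `k`-linear forms on covectors
(covectors are identified with their coordinate vectors `Fin n → ℝ`). -/
abbrev MultiVec (n k : ℕ) : Type := (Fin n → ℝ) [⋀^Fin k]→ₗ[ℝ] ℝ

variable {n : ℕ} {Ω : TopologicalSpace.Opens (Fin n → ℝ)}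

/-- Extension by zero of a function on `Ω`; it only serves to differentiate at points of `Ω`. -/
def zeroExt (f : Ω → ℝ) : (Fin n → ℝ) → ℝ := Function.extend Subtype.val f 0

theorem zeroExt_apply (f : Ω → ℝ) (x : Ω) : zeroExt f x = f x :=
  Subtype.val_injective.extend_apply f 0 x

/-- `f ∈ C^∞(Ω)`. -/
def IsSmooth (f : Ω → ℝ) : Prop := ContDiffOn ℝ ∞ (zeroExt f) (Ω : Set (Fin n → ℝ))

/-- The differential of `f` at `x ∈ Ω`, as a covector. -/
def dCov (f : Ω → ℝ) (x : Ω) : Fin n → ℝ :=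
  fun i => fderiv ℝ (zeroExt f) (x : Fin n → ℝ) (Pi.single i 1)

/-- The ring of all real functions on `Ω`. -/
def FunRing (Ω : TopologicalSpace.Opens (Fin n → ℝ)) : Type := Ω → ℝ

instance : CommRing (FunRing Ω) := inferInstanceAs (CommRing (Ω → ℝ))

instance : Algebra ℝ (FunRing Ω) := inferInstanceAs (Algebra ℝ (Ω → ℝ))

/-- (Not necessarily smooth) `k`-vector fields on `Ω`, with pointwise operations; functions on `Ω`
act by pointwise multiplication. -/
def MVField (Ω : TopologicalSpace.Opens (Fin n → ℝ)) (k : ℕ) : Type := Ω → MultiVec n k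

instance (k : ℕ) : AddCommGroup (MVField Ω k) := inferInstanceAs (AddCommGroup (Ω → MultiVec n k))

instance (k : ℕ) : Module ℝ (MVField Ω k) := inferInstanceAs (Module ℝ (Ω → MultiVec n k))

instance (k : ℕ) : Module (FunRing Ω) (MVField Ω k) where
  smul f Q := fun x => f x • Q x
  one_smul Q := funext fun x => one_smul ℝ (Q x)
  mul_smul f g Q := funext fun x => mul_smul (f x) (g x) (Q x)
  smul_zero f := funext fun x => smul_zero (f x)
  smul_add f Q Q' := funext fun x => smul_add (f x) (Q x) (Q' x)
  add_smul f g Q := funext fun x => add_smul (f x) (g x) (Q x)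
  zero_smul Q := funext fun x => zero_smul ℝ (Q x)

instance (k : ℕ) : IsScalarTower ℝ (FunRing Ω) (MVField Ω k) :=
  ⟨fun r f Q => funext fun x => mul_smul r (f x) (Q x)⟩

theorem MVField.add_apply {k : ℕ} (Q Q' : MVField Ω k) (x : Ω) (ξ : Fin k → (Fin n → ℝ)) :
    (Q + Q') x ξ = Q x ξ + Q' x ξ := rfl

theorem MVField.smul_apply {k : ℕ} (f : FunRing Ω) (Q : MVField Ω k) (x : Ω)
    (ξ : Fin k → (Fin n → ℝ)) :
    (f • Q) x ξ = f x * Q x ξ := rfl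

/-- A `k`-vector field is smooth when all its components are. -/
def IsSmoothField {k : ℕ} (Q : MVField Ω k) : Prop :=
  ∀ ξ : Fin k → (Fin n → ℝ), IsSmooth (fun x => Q x ξ)

theorem IsSmooth.differentiableAt {f : Ω → ℝ} (hf : IsSmooth f) (x : Ω) :
    DifferentiableAt ℝ (zeroExt f) (x : Fin n → ℝ) :=
  (hf.contDiffAt (Ω.isOpen.mem_nhds x.2)).differentiableAt (by simp)

theorem zeroExt_congr_on {f : Ω → ℝ} {F : (Fin n → ℝ) → ℝ} (h : ∀ x : Ω, f x = F x) :
    Set.EqOn (zeroExt f) F (Ω : Set (Fin n → ℝ)) := fun x hx => by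
  have := zeroExt_apply f ⟨x, hx⟩
  simp only at this
  rw [this, h]

theorem isSmooth_of_eq {f : Ω → ℝ} {F : (Fin n → ℝ) → ℝ}
    (hF : ContDiffOn ℝ ∞ F (Ω : Set (Fin n → ℝ))) (h : ∀ x : Ω, f x = F x) : IsSmooth f :=
  hF.congr (zeroExt_congr_on h)

theorem diff_of_eq {f : Ω → ℝ} {F : (Fin n → ℝ) → ℝ} (h : ∀ x : Ω, f x = F x) (x : Ω) :
    dCov f x = fun i => fderiv ℝ F (x : Fin n → ℝ) (Pi.single i 1) := by
  have : zeroExt f =ᶠ[𝓝 (x : Fin n → ℝ)] F :=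
    (zeroExt_congr_on h).eventuallyEq_of_mem (Ω.isOpen.mem_nhds x.2)
  funext i
  rw [dCov, this.fderiv_eq]

theorem IsSmooth.const (r : ℝ) : IsSmooth (fun _ : Ω => r) :=
  isSmooth_of_eq (F := fun _ => r) contDiffOn_const fun _ => rfl

theorem IsSmooth.add {f g : Ω → ℝ} (hf : IsSmooth f) (hg : IsSmooth g) :
    IsSmooth (fun x => f x + g x) :=
  isSmooth_of_eq (F := fun y => zeroExt f y + zeroExt g y) (ContDiffOn.add hf hg)
    fun x => by rw [zeroExt_apply, zeroExt_apply]

theorem IsSmooth.mul {f g : Ω → ℝ} (hf : IsSmooth f) (hg : IsSmooth g) :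
    IsSmooth (fun x => f x * g x) :=
  isSmooth_of_eq (F := fun y => zeroExt f y * zeroExt g y) (ContDiffOn.mul hf hg)
    fun x => by rw [zeroExt_apply, zeroExt_apply]

theorem diff_const (r : ℝ) (x : Ω) : dCov (fun _ : Ω => r) x = 0 := by
  rw [diff_of_eq (F := fun _ => r) fun _ => rfl]
  funext i
  simp

theorem diff_add {f g : Ω → ℝ} (hf : IsSmooth f) (hg : IsSmooth g) (x : Ω) :
    dCov (fun y => f y + g y) x = dCov f x + dCov g x := by
  rw [diff_of_eq (F := zeroExt f + zeroExt g) fun x => by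
    rw [Pi.add_apply, zeroExt_apply, zeroExt_apply]]
  funext i
  rw [fderiv_add (hf.differentiableAt x) (hg.differentiableAt x)]
  rfl

theorem diff_mul {f g : Ω → ℝ} (hf : IsSmooth f) (hg : IsSmooth g) (x : Ω) :
    dCov (fun y => f y * g y) x = f x • dCov g x + g x • dCov f x := by
  rw [diff_of_eq (F := zeroExt f * zeroExt g) fun x => by
    rw [Pi.mul_apply, zeroExt_apply, zeroExt_apply]]
  funext i
  rw [fderiv_mul (hf.differentiableAt x) (hg.differentiableAt x)]
  simp [zeroExt_apply, dCov]

/-! ### The Poisson coboundary operator of a bivector field `Λ` -/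

/-- The Hamiltonian vector field `H_f = {f, ·}`, i.e. `H_f(ξ) = Λ(df, ξ)`. -/
def ham (Λ : MVField Ω 2) (f : Ω → ℝ) (x : Ω) : MultiVec n 1 :=
  (Λ x).curryLeft (dCov f x)

/-- `ξ^#(f)` at `x`, for a covector `ξ`, where `ξ^#(η) = Λ(ξ, η)`. -/
def sharpDeriv (Λ : MVField Ω 2) (ξ : Fin n → ℝ) (f : Ω → ℝ) (x : Ω) : ℝ :=
  Λ x ![ξ, dCov f x]

/-- The bracket `{ξ, η}` at `x` of two constant `1`-forms `ξ, η`; these are exact, so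
`{ξ, η} = d(Λ(ξ, η))`. -/
def formBracket (Λ : MVField Ω 2) (ξ η : Fin n → ℝ) (x : Ω) : Fin n → ℝ :=
  dCov (fun y => Λ y ![ξ, η]) x

/-- The second sum `∑_{i<j} (-1)^{i+j} Q({ξᵢ,ξⱼ}, ξ₀, …, ξ̂ᵢ, …, ξ̂ⱼ, …, ξₖ)` in the formula
for `σ Q`; here `j = m + 1` with `i ≤ m`, and the sum is empty for `k = 0`. -/
def bracketTerm (Λ : MVField Ω 2) : {k : ℕ} → (MVField Ω k) → Ω →
    (Fin (k + 1) → (Fin n → ℝ)) → ℝ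
  | 0, _, _, _ => 0
  | k + 1, Q, x, ξ => ∑ i : Fin (k + 2), ∑ m : Fin (k + 1),
      if (i : ℕ) ≤ m then
        (-1 : ℝ) ^ ((i : ℕ) + m + 1) *
          Q x (Fin.cons (formBracket Λ (ξ i) (ξ m.succ) x) (m.removeNth (i.removeNth ξ)))
      else 0

/-- The value at `x`, on the covectors `ξ₀, …, ξₖ`, of `σ Q = [Λ, Q]`
(Schouten bracket), for a `k`-vector field `Q`:
`∑ᵢ (-1)ⁱ ξᵢ^#(Q(ξ₀, …, ξ̂ᵢ, …, ξₖ)) + ∑_{i<j} (-1)^{i+j} Q({ξᵢ,ξⱼ}, …, ξ̂ᵢ, …, ξ̂ⱼ, …)`.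
By tensoriality it is enough to evaluate on constant `1`-forms. -/
def sigma (Λ : MVField Ω 2) {k : ℕ} (Q : MVField Ω k) (x : Ω)
    (ξ : Fin (k + 1) → (Fin n → ℝ)) : ℝ :=
  (∑ i : Fin (k + 1), (-1 : ℝ) ^ (i : ℕ) *
    sharpDeriv Λ (ξ i) (fun y => Q y (i.removeNth ξ)) x) + bracketTerm Λ Q x ξ

/-- `P = σ Q` on `Ω`. -/
def IsSigma (Λ : MVField Ω 2) {k : ℕ} (Q : MVField Ω k)
    (P : MVField Ω (k + 1)) : Prop :=
  ∀ (x : Ω) (ξ : Fin (k + 1) → (Fin n → ℝ)), P x ξ = sigma Λ Q x ξ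

/-- A multivector field is tangential (a section of `⋀ᵏ(T𝓕)`, with `T𝓕` the image of `#`) when it
vanishes as soon as one of its arguments lies in the annihilator of `T𝓕`. -/
def IsTangential (Λ : MVField Ω 2) {k : ℕ} (Q : MVField Ω k) : Prop :=
  ∀ (x : Ω) (ξ : Fin k → (Fin n → ℝ)),
    (∃ i, ∀ η : Fin n → ℝ, Λ x ![η, ξ i] = 0) → Q x ξ = 0

/-- The algebra `I(Ω)` of Casimir functions: smooth functions with trivial Hamiltonian field. -/
def casimirs (Λ : MVField Ω 2) : Subalgebra ℝ (FunRing Ω) where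
  carrier := {f | IsSmooth f ∧ ∀ x, ham Λ f x = 0}
  mul_mem' := by
    rintro f g ⟨hf, hf'⟩ ⟨hg, hg'⟩
    refine ⟨hf.mul hg, fun x => ?_⟩
    have h := diff_mul hf hg x
    change (Λ x).curryLeft (dCov (fun y => f y * g y) x) = 0
    have h1 := hf' x
    have h2 := hg' x
    unfold ham at h1 h2
    rw [h, map_add, map_smul, map_smul, h1, h2, smul_zero, smul_zero, add_zero]
  add_mem' := by
    rintro f g ⟨hf, hf'⟩ ⟨hg, hg'⟩
    refine ⟨hf.add hg, fun x => ?_⟩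
    have h := diff_add hf hg x
    change (Λ x).curryLeft (dCov (fun y => f y + g y) x) = 0
    have h1 := hf' x
    have h2 := hg' x
    unfold ham at h1 h2
    rw [h, map_add, h1, h2, add_zero]
  algebraMap_mem' := by
    intro r
    refine ⟨IsSmooth.const r, fun x => ?_⟩
    change (Λ x).curryLeft (dCov (fun _ => r) x) = 0
    rw [diff_const, map_zero]

theorem lambda_skew {Λ : MVField Ω 2} (x : Ω) (ξ η : Fin n → ℝ) :
    Λ x ![ξ, η] = - Λ x ![η, ξ] := by
  have h := (Λ x).map_swap ![η, ξ] (i := 0) (j := 1) (by decide)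
  rw [← h]
  congr 1
  funext i
  fin_cases i <;> simp

theorem sharpDeriv_casimir {Λ : MVField Ω 2} {c : FunRing Ω} (hc : c ∈ casimirs Λ)
    (ξ : Fin n → ℝ) (x : Ω) : sharpDeriv Λ ξ c x = 0 := by
  have h : Λ x ![dCov c x, ξ] = 0 := by
    have := congrArg (fun q : MultiVec n 1 => q ![ξ]) (hc.2 x)
    simpa [ham] using this
  change Λ x ![ξ, dCov c x] = 0
  rw [lambda_skew, h, neg_zero]

theorem lambda_add (L : MultiVec n 2) (ξ η η' : Fin n → ℝ) :
    L ![ξ, η + η'] = L ![ξ, η] + L ![ξ, η'] := by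
  exact congrArg (fun q : MultiVec n 0 => q ![]) ((L.curryLeft ξ).curryLeft.map_add η η')

theorem lambda_smul (L : MultiVec n 2) (ξ η : Fin n → ℝ) (r : ℝ) :
    L ![ξ, r • η] = r * L ![ξ, η] := by
  exact congrArg (fun q : MultiVec n 0 => q ![]) ((L.curryLeft ξ).curryLeft.map_smul r η)

theorem bracketTerm_add (Λ : MVField Ω 2) {k : ℕ} (Q Q' : MVField Ω k) (x : Ω)
    (ξ : Fin (k + 1) → (Fin n → ℝ)) :
    bracketTerm Λ (Q + Q') x ξ = bracketTerm Λ Q x ξ + bracketTerm Λ Q' x ξ := by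
  cases k with
  | zero => simp [bracketTerm]
  | succ k =>
    simp only [bracketTerm, ← Finset.sum_add_distrib]
    refine Finset.sum_congr rfl fun i _ => Finset.sum_congr rfl fun m _ => ?_
    split_ifs
    · rw [MVField.add_apply, mul_add]
    · rw [add_zero]

theorem bracketTerm_smul (Λ : MVField Ω 2) {k : ℕ} (c : Ω → ℝ) (Q : MVField Ω k)
    (x : Ω) (ξ : Fin (k + 1) → (Fin n → ℝ)) :
    bracketTerm Λ (fun y => c y • Q y) x ξ = c x * bracketTerm Λ Q x ξ := by
  cases k with
  | zero => simp [bracketTerm]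
  | succ k =>
    simp only [bracketTerm, Finset.mul_sum]
    refine Finset.sum_congr rfl fun i _ => Finset.sum_congr rfl fun m _ => ?_
    split_ifs
    · rw [AlternatingMap.smul_apply, smul_eq_mul]; ring
    · rw [mul_zero]

theorem sigma_add (Λ : MVField Ω 2) {k : ℕ} {Q Q' : MVField Ω k}
    (hQ : IsSmoothField Q) (hQ' : IsSmoothField Q') (x : Ω) (ξ : Fin (k + 1) → (Fin n → ℝ)) :
    sigma Λ (Q + Q') x ξ = sigma Λ Q x ξ + sigma Λ Q' x ξ := by
  have h : ∀ i : Fin (k + 1), sharpDeriv Λ (ξ i) (fun y => (Q + Q') y (i.removeNth ξ)) x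
      = sharpDeriv Λ (ξ i) (fun y => Q y (i.removeNth ξ)) x
        + sharpDeriv Λ (ξ i) (fun y => Q' y (i.removeNth ξ)) x := by
    intro i
    have hd := diff_add (hQ (i.removeNth ξ)) (hQ' (i.removeNth ξ)) x
    change Λ x ![ξ i, dCov (fun y => Q y (i.removeNth ξ) + Q' y (i.removeNth ξ)) x] = _
    rw [hd, lambda_add]
    rfl
  simp only [sigma, h, bracketTerm_add, mul_add, Finset.sum_add_distrib]
  ring

theorem sigma_smul {Λ : MVField Ω 2} {k : ℕ} {c : FunRing Ω} (hc : c ∈ casimirs Λ)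
    {Q : MVField Ω k} (hQ : IsSmoothField Q) (x : Ω) (ξ : Fin (k + 1) → (Fin n → ℝ)) :
    sigma Λ (fun y => c y • Q y) x ξ = c x * sigma Λ Q x ξ := by
  have h : ∀ i : Fin (k + 1), sharpDeriv Λ (ξ i) (fun y => (c y • Q y) (i.removeNth ξ)) x
      = c x * sharpDeriv Λ (ξ i) (fun y => Q y (i.removeNth ξ)) x := by
    intro i
    have hd := diff_mul hc.1 (hQ (i.removeNth ξ)) x
    change Λ x ![ξ i, dCov (fun y => c y * Q y (i.removeNth ξ)) x] = _
    have h0 := sharpDeriv_casimir hc (ξ i) x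
    unfold sharpDeriv at h0 ⊢
    rw [hd, lambda_add, lambda_smul, lambda_smul, h0, mul_zero, add_zero]
  have hb := bracketTerm_smul Λ c Q x ξ
  simp only [sigma, h, mul_add, Finset.mul_sum]
  refine congrArg₂ (· + ·) ?_ hb
  refine Finset.sum_congr rfl fun i _ => ?_
  ring

/-- `𝒱ᵏ(Ω)`, the `I(Ω)`-module of smooth `k`-vector fields on `Ω`. -/
def fields (Λ : MVField Ω 2) (k : ℕ) : Submodule (casimirs Λ) (MVField Ω k) where
  carrier := {Q | IsSmoothField Q}
  add_mem' := fun hQ hQ' ξ => (hQ ξ).add (hQ' ξ)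
  zero_mem' := fun _ => IsSmooth.const 0
  smul_mem' := fun c _ hQ ξ => c.2.1.mul (hQ ξ)

/-- `𝒱_{0,k}(Ω)`, the `I(Ω)`-module of smooth tangential `k`-vector fields on `Ω`. -/
def tangentialFields (Λ : MVField Ω 2) (k : ℕ) :
    Submodule (casimirs Λ) (MVField Ω k) where
  carrier := {Q | IsSmoothField Q ∧ IsTangential Λ Q}
  add_mem' := fun hQ hQ' => ⟨fun ξ => (hQ.1 ξ).add (hQ'.1 ξ), fun x ξ h => by
    rw [MVField.add_apply, hQ.2 x ξ h, hQ'.2 x ξ h, add_zero]⟩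
  zero_mem' := ⟨fun _ => IsSmooth.const 0, fun _ _ _ => rfl⟩
  smul_mem' := fun c Q hQ => ⟨fun ξ => c.2.1.mul (hQ.1 ξ), fun x ξ h => by
    change c.1 x • Q x ξ = 0
    rw [hQ.2 x ξ h, smul_zero]⟩

/-- Smooth `k`-vector fields `Q` with `σ Q = 0`. -/
def sigmaKer (Λ : MVField Ω 2) (k : ℕ) : Submodule (casimirs Λ) (MVField Ω k) where
  carrier := {Q | IsSmoothField Q ∧ IsSigma Λ Q 0}
  add_mem' := fun {Q Q'} hQ hQ' => ⟨fun ξ => (hQ.1 ξ).add (hQ'.1 ξ), fun x ξ => by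
    rw [sigma_add Λ hQ.1 hQ'.1, ← hQ.2 x ξ, ← hQ'.2 x ξ]
    exact (add_zero (0 : ℝ)).symm⟩
  zero_mem' := ⟨fun _ => IsSmooth.const 0, fun x ξ => by
    have h0 : IsSmoothField (0 : MVField Ω k) := fun _ => IsSmooth.const 0
    have h := sigma_add Λ h0 h0 x ξ
    rw [add_zero] at h
    have h' : sigma Λ (0 : MVField Ω k) x ξ = 0 := by linarith
    rw [h']
    rfl⟩
  smul_mem' := fun c Q hQ => ⟨fun ξ => c.2.1.mul (hQ.1 ξ), fun x ξ => by
    have h := sigma_smul c.2 hQ.1 x ξ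
    change (0 : ℝ) = sigma Λ (fun y => c.1 y • Q y) x ξ
    rw [h, ← hQ.2 x ξ]
    exact (mul_zero (c.1 x)).symm⟩

/-- The image under `σ` of the smooth `k`-vector fields that belong to `C`. -/
def sigmaImage (Λ : MVField Ω 2) {k : ℕ}
    (C : Submodule (casimirs Λ) (MVField Ω k)) :
    Submodule (casimirs Λ) (MVField Ω (k + 1)) where
  carrier := {P | ∃ Q ∈ C, IsSmoothField Q ∧ IsSigma Λ Q P}
  add_mem' := by
    rintro P P' ⟨Q, hQC, hQ, h⟩ ⟨Q', hQC', hQ', h'⟩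
    refine ⟨Q + Q', C.add_mem hQC hQC', fun ξ => (hQ ξ).add (hQ' ξ), fun x ξ => ?_⟩
    rw [sigma_add Λ hQ hQ', ← h x ξ, ← h' x ξ]
    rfl
  zero_mem' := ⟨0, C.zero_mem, (sigmaKer Λ k).zero_mem.1, (sigmaKer Λ k).zero_mem.2⟩
  smul_mem' := by
    rintro c P ⟨Q, hQC, hQ, h⟩
    refine ⟨c • Q, C.smul_mem c hQC, fun ξ => c.2.1.mul (hQ ξ), fun x ξ => ?_⟩
    have h1 := sigma_smul c.2 hQ x ξ
    change c.1 x * P x ξ = sigma Λ (fun y => c.1 y • Q y) x ξ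
    rw [h1, h x ξ]

/-- Degree `k` coboundaries `σ(C^{k-1}) ∩ Cᵏ` of the complex `(C, σ)`. -/
def coboundaries (Λ : MVField Ω 2)
    (C : (k : ℕ) → Submodule (casimirs Λ) (MVField Ω k)) :
    (k : ℕ) → Submodule (casimirs Λ) (MVField Ω k)
  | 0 => ⊥
  | k + 1 => C (k + 1) ⊓ sigmaImage Λ (C k)

/-- Degree `k` cocycles of the complex `(C, σ)`. -/
abbrev cocycles (Λ : MVField Ω 2)
    (C : (k : ℕ) → Submodule (casimirs Λ) (MVField Ω k)) (k : ℕ) :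
    Submodule (casimirs Λ) (MVField Ω k) := C k ⊓ sigmaKer Λ k

/-- Degree `k` cohomology, an `I(Ω)`-module, of the complex `(C, σ)`. -/
def Cohomology (Λ : MVField Ω 2)
    (C : (k : ℕ) → Submodule (casimirs Λ) (MVField Ω k)) (k : ℕ) : Type :=
  (cocycles Λ C k) ⧸ (coboundaries Λ C k).submoduleOf (cocycles Λ C k)

section

variable (Λ : MVField Ω 2) (C : (k : ℕ) → Submodule (casimirs Λ) (MVField Ω k)) (k : ℕ)

instance : AddCommGroup (Cohomology Λ C k) :=
  inferInstanceAs (AddCommGroup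
    ((cocycles Λ C k) ⧸ (coboundaries Λ C k).submoduleOf (cocycles Λ C k)))

instance : Module (casimirs Λ) (Cohomology Λ C k) :=
  inferInstanceAs (Module (casimirs Λ)
    ((cocycles Λ C k) ⧸ (coboundaries Λ C k).submoduleOf (cocycles Λ C k)))

/-- Real scalars act as constant Casimir functions. -/
instance : Module ℝ (Cohomology Λ C k) := Module.compHom _ (algebraMap ℝ (casimirs Λ))

instance : IsScalarTower ℝ (casimirs Λ) (Cohomology Λ C k) :=
  ⟨fun r c h => by
    rw [Algebra.smul_def, mul_smul]
    rfl⟩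

end

/-- The P-cohomology `Hᵏ_Λ(Ω)`. -/
abbrev HP (Λ : MVField Ω 2) (k : ℕ) : Type := Cohomology Λ (fields Λ) k

/-- The TP-cohomology `Hᵏ_{Λ,tan}(Ω)` (on tangential fields, `σ'' = σ`). -/
abbrev HTan (Λ : MVField Ω 2) (k : ℕ) : Type := Cohomology Λ (tangentialFields Λ) k

/-- The class in `Hᵏ_{Λ,tan}(Ω)` of a tangential cocycle. -/
def tanClass (Λ : MVField Ω 2) (k : ℕ) (Q : cocycles Λ (tangentialFields Λ) k) : HTan Λ k :=
  ((coboundaries Λ (tangentialFields Λ) k).submoduleOf (cocycles Λ (tangentialFields Λ) k)).mkQ Q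

/-- A function, as a `0`-vector field. -/
def ofFun (f : Ω → ℝ) : MVField Ω 0 :=
  fun x => AlternatingMap.constOfIsEmpty ℝ (Fin n → ℝ) (Fin 0) (f x)

/-! ### The Lie algebra `sl(2)` and its dual -/

/-- The bracket of `sl(2)` in the basis `X₁, X₂, X₃` (indices `0, 1, 2`) with
`[X₁, X₂] = -X₃`, `[X₃, X₁] = X₂`, `[X₃, X₂] = -X₁`. -/
def slBracket (ξ η : Fin 3 → ℝ) : Fin 3 → ℝ :=
  ![ξ 1 * η 2 - ξ 2 * η 1, ξ 2 * η 0 - ξ 0 * η 2, -(ξ 0 * η 1 - ξ 1 * η 0)]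

/-- `Ω = sl(2)^* \ {0}`, in the coordinates dual to `X₁, X₂, X₃`. -/
def slΩ : TopologicalSpace.Opens (Fin 3 → ℝ) := ⟨{0}ᶜ, isOpen_compl_singleton⟩

/-- The linear Poisson structure `Λ_x(ξ, η) = ⟨x, [ξ, η]⟩` on `Ω`. -/
def slΛ : MVField slΩ 2 := fun x => {
  toFun v := (x : Fin 3 → ℝ) ⬝ᵥ slBracket (v 0) (v 1)
  map_update_add' := by
    intro inst v i a b
    rw [Subsingleton.elim inst (instDecidableEqFin 2)]
    fin_cases i <;> simp [slBracket, dotProduct, Fin.sum_univ_three] <;> ring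
  map_update_smul' := by
    intro inst v i c a
    rw [Subsingleton.elim inst (instDecidableEqFin 2)]
    fin_cases i <;> simp [slBracket, dotProduct, Fin.sum_univ_three] <;> ring
  map_eq_zero_of_eq' := by
    intro v i j h hij
    have h01 : v 0 = v 1 := by
      fin_cases i <;> fin_cases j <;> simp_all
    simp [slBracket, dotProduct, Fin.sum_univ_three, h01]
    ring }

/-- The infinitesimal coadjoint action, `⟨ad*_X μ, Y⟩ = -⟨μ, [X, Y]⟩`. -/
def coad (X : Fin 3 → ℝ) : (Fin 3 → ℝ) →L[ℝ] (Fin 3 → ℝ) :=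
  LinearMap.toContinuousLinearMap
    { toFun := fun μ i => -(μ ⬝ᵥ slBracket X (Pi.single i 1))
      map_add' := fun μ ν => by
        funext i
        simp only [add_dotProduct, Pi.add_apply]
        ring
      map_smul' := fun c μ => by
        funext i
        simp }

/-- Invariance under the coadjoint action of the connected group `G` with Lie algebra `sl(2)`
(`G` is generated by the elements `exp X`, and `Ad*(exp X) = exp(ad*_X)`). -/
def IsGInvariant (F : (Fin 3 → ℝ) → ℝ) : Prop :=
  ∀ (X μ : Fin 3 → ℝ), F (NormedSpace.exp (coad X) μ) = F μ

/-- `S(g)^G`: (restrictions to `Ω` of) `G`-invariant polynomial functions on `sl(2)^*`. -/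
def invPoly : Subalgebra ℝ (casimirs slΛ) where
  carrier := {c | ∃ p : MvPolynomial (Fin 3) ℝ,
    IsGInvariant (fun μ => MvPolynomial.eval μ p) ∧ ∀ x : slΩ, c.1 x = MvPolynomial.eval x.1 p}
  mul_mem' := by
    rintro c c' ⟨p, hp, h⟩ ⟨p', hp', h'⟩
    refine ⟨p * p', fun X μ => ?_, fun x => ?_⟩
    · simpa using congrArg₂ (· * ·) (hp X μ) (hp' X μ)
    · exact (congrArg₂ (· * ·) (h x) (h' x)).trans (map_mul (MvPolynomial.eval x.1) p p').symm
  add_mem' := by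
    rintro c c' ⟨p, hp, h⟩ ⟨p', hp', h'⟩
    refine ⟨p + p', fun X μ => ?_, fun x => ?_⟩
    · simpa using congrArg₂ (· + ·) (hp X μ) (hp' X μ)
    · exact (congrArg₂ (· + ·) (h x) (h' x)).trans (map_add (MvPolynomial.eval x.1) p p').symm
  algebraMap_mem' r := ⟨MvPolynomial.C r, fun X μ => by simp,
    fun x => (MvPolynomial.eval_C r).symm⟩

/-- `A(g)^G`: (restrictions to `Ω` of) `G`-invariant real-analytic functions on `sl(2)^*`. -/
def invAnalytic : Subalgebra ℝ (casimirs slΛ) where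
  carrier := {c | ∃ F : (Fin 3 → ℝ) → ℝ, AnalyticOnNhd ℝ F Set.univ ∧
    IsGInvariant F ∧ ∀ x : slΩ, c.1 x = F x.1}
  mul_mem' := by
    rintro c c' ⟨p, hpa, hp, h⟩ ⟨p', hpa', hp', h'⟩
    refine ⟨p * p', hpa.mul hpa', fun X μ => ?_, fun x => ?_⟩
    · exact congrArg₂ (· * ·) (hp X μ) (hp' X μ)
    · exact congrArg₂ (· * ·) (h x) (h' x)
  add_mem' := by
    rintro c c' ⟨p, hpa, hp, h⟩ ⟨p', hpa', hp', h'⟩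
    refine ⟨p + p', hpa.add hpa', fun X μ => ?_, fun x => ?_⟩
    · exact congrArg₂ (· + ·) (hp X μ) (hp' X μ)
    · exact congrArg₂ (· + ·) (h x) (h' x)
  algebraMap_mem' r := ⟨fun _ => r, analyticOnNhd_const, fun X μ => rfl, fun x => rfl⟩

/-- Infinite dimensional over `ℝ`, and not finitely generated over `S(g)^G` nor `A(g)^G`. -/
def IsInfiniteDim (H : Type) [AddCommGroup H] [Module ℝ H] [Module (casimirs slΛ) H] : Prop :=
  ¬ Module.Finite ℝ H ∧ ¬ Module.Finite invPoly H ∧ ¬ Module.Finite invAnalytic H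

/-- `x₁² + x₂² + x₃²`. -/
def normSq3 (x : Fin 3 → ℝ) : ℝ := x 0 ^ 2 + x 1 ^ 2 + x 2 ^ 2

/-- `t̂_α = (x₁² + x₂² + x₃²)^{-α}`. -/
def tHat (α : ℝ) (x : slΩ) : ℝ := 1 / normSq3 x.1 ^ α

/-- `k̂_α = exp(α / (x₁² + x₂² + x₃²)) / (x₁² + x₂² + x₃²)²`. -/
def kHat (α : ℝ) (x : slΩ) : ℝ := Real.exp (α / normSq3 x.1) / normSq3 x.1 ^ 2

/-- The vector field `a H_{x₃}`. -/
def aH3 (a : slΩ → ℝ) : MVField slΩ 1 := fun x => a x • ham slΛ (fun y => y.1 2) x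

/-- The bivector field `φ Λ`. -/
def mulΛ (φ : slΩ → ℝ) : MVField slΩ 2 := fun x => φ x • slΛ x

/-- For `z > 0`, the parameterization of `{x₁² + x₂² - x₃² > 0}` (with
`x₁² + x₂² - x₃² = z²`, `x₃ = p`). -/
def param (p q z : ℝ) : Fin 3 → ℝ :=
  ![-p * Real.sin q + z * Real.cos q, -p * Real.cos q - z * Real.sin q, p]

end PoissonTP

end

noncomputable section

namespace PoissonTP

/-! ### Explicit formulas for `sigma` in degrees 0 to 3. -/

section General

variable {n : ℕ} {Ω : TopologicalSpace.Opens (Fin n → ℝ)} (Λ : MVField Ω 2)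

/-! The obstruction comes from the way leaves degenerate at the puncture. For z > 0 the one-sheeted
hyperboloid x₁² + x₂² - x₃² = z² is a leaf, ruled by the lines p ↦ `param p q z`, and (p, q) are
Darboux coordinates on it. As z → 0 the rulings pass through the missing origin at p = 0, while
their points with p = ±1 converge inside Ω. If a field is exact, the integral of its coefficient
over -1 ≤ p ≤ 1 becomes, by Stokes on the leaf, a difference of boundary values at p = ±1, which has
a finite limit.

In degree 1 this is the fundamental theorem of calculus along a ruling
(`limit_obstruction_degree_one`). In degrees 2 and 3 the coefficient φ is a divergence ∂_q G + ∂_p b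
on the leaf with G periodic in q. Integrating over q kills G, and what remains is the flux of b
through p = ±1 (`limit_of_exact_on_leaves`). Tangentiality of the primitive plays no role, so the
same obstruction serves the TP- and the P-complex; `HasLimitObstruction` records it for an arbitrary
subcomplex.

The candidates are radial functions times H_{x₃}, Λ or ∂₁∧∂₂∧∂₃. A linear relation between their
classes with Casimir coefficients gᵢ, which depend on z alone on these leaves, says that Σ gᵢ(z) ·
`leafIntegral` ψᵢ z converges as z → 0⁺. For the two families the leaf integrals diverge at rates
strictly ordered by α, so the largest index whose coefficient has a nonzero germ would dominate the
sum (`eventuallyEq_zero_of_tendsto_sum`). For the exponential family the domination survives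
multiplication by any power of z. Analytic coefficients are handled this way: a nonzero germ is z^m
times a unit, and a vanishing germ forces the invariant function to vanish by the identity theorem.
An infinite independent family over a nontrivial commutative ring excludes finite generation.

The remaining degrees are algebra: in degree 0 the cocycle condition is the Casimir condition, and
above degree 2 there are no tangential multivectors on leaves of dimension at most 2. -/

theorem sigma_degree_zero (Q : MVField Ω 0) (x : Ω) (ξ : Fin 1 → (Fin n → ℝ)) :
    sigma Λ Q x ξ = Λ x ![ξ 0, dCov (fun y => Q y ![]) x] := by
  have h : Fin.tail ξ = ![] := Subsingleton.elim _ _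
  simp [sigma, bracketTerm, sharpDeriv, h]

theorem sigma_degree_one (Q : MVField Ω 1) (x : Ω) (ξ : Fin 2 → (Fin n → ℝ)) :
    sigma Λ Q x ξ = Λ x ![ξ 0, dCov (fun y => Q y ![ξ 1]) x]
      - Λ x ![ξ 1, dCov (fun y => Q y ![ξ 0]) x] - Q x ![formBracket Λ (ξ 0) (ξ 1) x] := by
  have h0 : Fin.removeNth (0 : Fin 2) ξ = ![ξ 1] := by
    funext i; fin_cases i; rfl
  have h1 : Fin.removeNth (1 : Fin 2) ξ = ![ξ 0] := by
    funext i; fin_cases i; rfl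
  have h2 : ∀ (v : Fin n → ℝ) (w : Fin 0 → (Fin n → ℝ)), (Fin.cons v w : Fin 1 → _) = ![v] := by
    intro v w; funext i; fin_cases i; rfl
  simp [sigma, bracketTerm, sharpDeriv, Fin.sum_univ_succ, h0, h1, h2]
  ring

theorem sigma_degree_two (Q : MVField Ω 2) (x : Ω) (ξ : Fin 3 → (Fin n → ℝ)) :
    sigma Λ Q x ξ = Λ x ![ξ 0, dCov (fun y => Q y ![ξ 1, ξ 2]) x]
      - Λ x ![ξ 1, dCov (fun y => Q y ![ξ 0, ξ 2]) x]
      + Λ x ![ξ 2, dCov (fun y => Q y ![ξ 0, ξ 1]) x]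
      - Q x ![formBracket Λ (ξ 0) (ξ 1) x, ξ 2] + Q x ![formBracket Λ (ξ 0) (ξ 2) x, ξ 1]
      - Q x ![formBracket Λ (ξ 1) (ξ 2) x, ξ 0] := by
  have h0 : Fin.removeNth (0 : Fin 3) ξ = ![ξ 1, ξ 2] := by
    funext i; fin_cases i <;> rfl
  have h1 : Fin.removeNth (1 : Fin 3) ξ = ![ξ 0, ξ 2] := by
    funext i; fin_cases i <;> rfl
  have h2 : Fin.removeNth (2 : Fin 3) ξ = ![ξ 0, ξ 1] := by
    funext i; fin_cases i <;> rfl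
  have h3 : ∀ u v w : Fin n → ℝ,
      (Fin.cons u (Fin.removeNth (0 : Fin 2) ![v, w]) : Fin 2 → _) = ![u, w] := by
    intro u v w; funext i; fin_cases i <;> rfl
  have h4 : ∀ u v w : Fin n → ℝ,
      (Fin.cons u (Fin.removeNth (1 : Fin 2) ![v, w]) : Fin 2 → _) = ![u, v] := by
    intro u v w; funext i; fin_cases i <;> rfl
  change (∑ i : Fin 3, _) + (∑ i : Fin 3, ∑ m : Fin 2, _) = _
  simp only [sharpDeriv, Fin.sum_univ_three, Fin.sum_univ_two, h0, h1, h2,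
    h3, h4]
  simp
  ring

theorem sigma_degree_three (Q : MVField Ω 3) (x : Ω) (ξ : Fin 4 → (Fin n → ℝ)) :
    sigma Λ Q x ξ = Λ x ![ξ 0, dCov (fun y => Q y ![ξ 1, ξ 2, ξ 3]) x]
      - Λ x ![ξ 1, dCov (fun y => Q y ![ξ 0, ξ 2, ξ 3]) x]
      + Λ x ![ξ 2, dCov (fun y => Q y ![ξ 0, ξ 1, ξ 3]) x]
      - Λ x ![ξ 3, dCov (fun y => Q y ![ξ 0, ξ 1, ξ 2]) x]
      - Q x ![formBracket Λ (ξ 0) (ξ 1) x, ξ 2, ξ 3]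
      + Q x ![formBracket Λ (ξ 0) (ξ 2) x, ξ 1, ξ 3]
      - Q x ![formBracket Λ (ξ 0) (ξ 3) x, ξ 1, ξ 2]
      - Q x ![formBracket Λ (ξ 1) (ξ 2) x, ξ 0, ξ 3]
      + Q x ![formBracket Λ (ξ 1) (ξ 3) x, ξ 0, ξ 2]
      - Q x ![formBracket Λ (ξ 2) (ξ 3) x, ξ 0, ξ 1] := by
  have h0 : Fin.removeNth (0 : Fin 4) ξ = ![ξ 1, ξ 2, ξ 3] := by
    funext i; fin_cases i <;> rfl
  have h1 : Fin.removeNth (1 : Fin 4) ξ = ![ξ 0, ξ 2, ξ 3] := by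
    funext i; fin_cases i <;> rfl
  have h2 : Fin.removeNth (2 : Fin 4) ξ = ![ξ 0, ξ 1, ξ 3] := by
    funext i; fin_cases i <;> rfl
  have h3 : Fin.removeNth (3 : Fin 4) ξ = ![ξ 0, ξ 1, ξ 2] := by
    funext i; fin_cases i <;> rfl
  have k0 : ∀ u v w t : Fin n → ℝ,
      (Fin.cons u (Fin.removeNth (0 : Fin 3) ![v, w, t]) : Fin 3 → _) = ![u, w, t] := by
    intro u v w t; funext i; fin_cases i <;> rfl
  have k1 : ∀ u v w t : Fin n → ℝ,
      (Fin.cons u (Fin.removeNth (1 : Fin 3) ![v, w, t]) : Fin 3 → _) = ![u, v, t] := by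
    intro u v w t; funext i; fin_cases i <;> rfl
  have k2 : ∀ u v w t : Fin n → ℝ,
      (Fin.cons u (Fin.removeNth (2 : Fin 3) ![v, w, t]) : Fin 3 → _) = ![u, v, w] := by
    intro u v w t; funext i; fin_cases i <;> rfl
  change (∑ i : Fin 4, _) + (∑ i : Fin 4, ∑ m : Fin 3, _) = _
  simp only [sharpDeriv, Fin.sum_univ_four, Fin.sum_univ_three, h0, h1, h2,
    h3, k0, k1, k2]
  simp
  ring

end General

/-! ### The linear Poisson structure in coordinates, and the candidate cocycles in degrees 1, 2, 3.
-/

theorem slΛ_apply (x : slΩ) (ξ η : Fin 3 → ℝ) :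
    slΛ x ![ξ, η] = x.1 0 * (ξ 1 * η 2 - ξ 2 * η 1) + x.1 1 * (ξ 2 * η 0 - ξ 0 * η 2)
      - x.1 2 * (ξ 0 * η 1 - ξ 1 * η 0) := by
  change (x : Fin 3 → ℝ) ⬝ᵥ slBracket ξ η = _
  simp [slBracket, dotProduct, Fin.sum_univ_three]
  ring

theorem dCov_dotProduct (v : Fin 3 → ℝ) (x : slΩ) :
    dCov (fun y : slΩ => (y : Fin 3 → ℝ) ⬝ᵥ v) x = v := by
  let L : (Fin 3 → ℝ) →L[ℝ] ℝ := LinearMap.toContinuousLinearMap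
    { toFun := fun y => y ⬝ᵥ v
      map_add' := fun a b => add_dotProduct a b v
      map_smul' := fun c a => smul_dotProduct c a v }
  rw [diff_of_eq (f := fun y : slΩ => (y : Fin 3 → ℝ) ⬝ᵥ v) (F := L) fun x => rfl]
  funext i
  rw [L.fderiv]
  change Pi.single i 1 ⬝ᵥ v = v i
  simp

theorem isSmooth_dotProduct (v : Fin 3 → ℝ) : IsSmooth (fun y : slΩ => (y : Fin 3 → ℝ) ⬝ᵥ v) := by
  refine isSmooth_of_eq (F := fun y => y ⬝ᵥ v) (ContDiff.contDiffOn ?_) fun _ => rfl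
  unfold dotProduct
  fun_prop

theorem formBracket_slΛ (ξ η : Fin 3 → ℝ) (x : slΩ) :
    formBracket slΛ ξ η x = slBracket ξ η :=
  dCov_dotProduct (slBracket ξ η) x

theorem dCov_mul_slΛ {φ : slΩ → ℝ} (hφ : IsSmooth φ) (ξ η : Fin 3 → ℝ) (x : slΩ) :
    dCov (fun y => φ y * slΛ y ![ξ, η]) x = φ x • slBracket ξ η + slΛ x ![ξ, η] • dCov φ x := by
  have h := diff_mul hφ (isSmooth_dotProduct (slBracket ξ η)) x
  rw [dCov_dotProduct] at h
  exact h

theorem dCov_mul_const {φ : slΩ → ℝ} (hφ : IsSmooth φ) (r : ℝ) (x : slΩ) :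
    dCov (fun y => φ y * r) x = r • dCov φ x := by
  rw [diff_mul hφ (IsSmooth.const r), diff_const]
  simp

theorem slCoord_dCov (i : Fin 3) (x : slΩ) :
    dCov (fun y : slΩ => y.1 i) x = Pi.single i 1 := by
  have := dCov_dotProduct (Pi.single i 1) x
  simpa using this

theorem aH3_apply (a : slΩ → ℝ) (x : slΩ) (ξ : Fin 3 → ℝ) :
    aH3 a x ![ξ] = a x * slΛ x ![![0, 0, 1], ξ] := by
  have h : (Pi.single 2 1 : Fin 3 → ℝ) = ![0, 0, 1] := by
    funext i; fin_cases i <;> simp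
  change a x * slΛ x ![dCov (fun y : slΩ => y.1 2) x, ξ] = _
  rw [slCoord_dCov, h]

theorem mulΛ_apply (φ : slΩ → ℝ) (x : slΩ) (ξ : Fin 2 → Fin 3 → ℝ) :
    mulΛ φ x ξ = φ x * slΛ x ξ := rfl

/-- The trivector field `φ ∂₁ ∧ ∂₂ ∧ ∂₃`. -/
def mulVol (φ : slΩ → ℝ) : MVField slΩ 3 := fun x => φ x • Matrix.detRowAlternating

theorem mulVol_apply (φ : slΩ → ℝ) (x : slΩ) (u v w : Fin 3 → ℝ) :
    mulVol φ x ![u, v, w] = φ x * (u 0 * (v 1 * w 2 - v 2 * w 1) - u 1 * (v 0 * w 2 - v 2 * w 0)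
      + u 2 * (v 0 * w 1 - v 1 * w 0)) := by
  change φ x * Matrix.det (Matrix.of ![u, v, w]) = _
  rw [Matrix.det_fin_three]
  simp
  left
  ring

theorem vec_one_eq {E : Type*} (ξ : Fin 1 → E) : ξ = ![ξ 0] := by
  funext i; fin_cases i; rfl

theorem vec_two_eq {E : Type*} (ξ : Fin 2 → E) : ξ = ![ξ 0, ξ 1] := by
  funext i; fin_cases i <;> rfl

theorem isSmoothField_aH3 {a : slΩ → ℝ} (ha : IsSmooth a) : IsSmoothField (aH3 a) := by
  intro ξ
  rw [vec_one_eq ξ]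
  simp only [aH3_apply]
  exact ha.mul (isSmooth_dotProduct (slBracket _ _))

theorem isSmoothField_mulΛ {φ : slΩ → ℝ} (hφ : IsSmooth φ) : IsSmoothField (mulΛ φ) :=
  fun ξ => hφ.mul (isSmooth_dotProduct (slBracket (ξ 0) (ξ 1)))

theorem isSmoothField_mulVol {φ : slΩ → ℝ} (hφ : IsSmooth φ) : IsSmoothField (mulVol φ) :=
  fun ξ => hφ.mul (IsSmooth.const (Matrix.det ξ))

theorem isTangential_aH3 (a : slΩ → ℝ) : IsTangential slΛ (aH3 a) := by
  rintro x ξ ⟨i, hi⟩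
  rw [vec_one_eq ξ, aH3_apply, ← Subsingleton.elim i 0, hi, mul_zero]

theorem isTangential_mulΛ (φ : slΩ → ℝ) : IsTangential slΛ (mulΛ φ) := by
  rintro x ξ ⟨i, hi⟩
  rw [vec_two_eq ξ, mulΛ_apply]
  fin_cases i
  · have hi : ∀ η, slΛ x ![η, ξ 0] = 0 := hi
    rw [lambda_skew, hi]; simp
  · have hi : ∀ η, slΛ x ![η, ξ 1] = 0 := hi
    rw [hi, mul_zero]

/-- On two-dimensional leaves the bivector σ(a H_{x₃}) is a multiple of Λ; up to sign the factor is
{x₃, a}. -/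
theorem isSigma_aH3 {a : slΩ → ℝ} (ha : IsSmooth a)
    (h : ∀ x, slΛ x ![![0, 0, 1], dCov a x] = 0) : IsSigma slΛ (aH3 a) 0 := by
  intro x ξ
  have h := h x
  rw [sigma_degree_one]
  simp only [aH3_apply, dCov_mul_slΛ ha, formBracket_slΛ]
  simp only [slΛ_apply] at h ⊢
  simp [slBracket] at h ⊢
  change (0 : ℝ) = _
  linear_combination -(x.1 0 * (ξ 0 1 * ξ 1 2 - ξ 0 2 * ξ 1 1)
    + x.1 1 * (ξ 0 2 * ξ 1 0 - ξ 0 0 * ξ 1 2) - x.1 2 * (ξ 0 0 * ξ 1 1 - ξ 0 1 * ξ 1 0)) * h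

/-- Since [Λ, Λ] = 0, only a term of the form H_φ ∧ Λ could survive, and it vanishes because Λ has
rank 2. No condition on φ is needed. -/
theorem isSigma_mulΛ {φ : slΩ → ℝ} (hφ : IsSmooth φ) : IsSigma slΛ (mulΛ φ) 0 := by
  intro x ξ
  rw [sigma_degree_two]
  simp only [mulΛ_apply, dCov_mul_slΛ hφ, formBracket_slΛ]
  simp only [slΛ_apply]
  simp [slBracket]
  change (0 : ℝ) = _
  ring

/-- A 4-vector in dimension 3 is zero. -/
theorem isSigma_mulVol {φ : slΩ → ℝ} (hφ : IsSmooth φ) : IsSigma slΛ (mulVol φ) 0 := by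
  intro x ξ
  rw [sigma_degree_three]
  simp only [mulVol_apply, dCov_mul_const hφ, formBracket_slΛ]
  simp only [slΛ_apply]
  simp [slBracket]
  change (0 : ℝ) = _
  ring

/-! ### Radial functions -/

theorem normSq3_pos {x : Fin 3 → ℝ} (hx : x ∈ slΩ) : 0 < normSq3 x := by
  have hx' : x ≠ 0 := hx
  by_contra! h
  unfold normSq3 at h
  apply hx'
  have h0 : x 0 = 0 := by nlinarith [sq_nonneg (x 0), sq_nonneg (x 1), sq_nonneg (x 2)]
  have h1 : x 1 = 0 := by nlinarith [sq_nonneg (x 0), sq_nonneg (x 1), sq_nonneg (x 2)]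
  have h2 : x 2 = 0 := by nlinarith [sq_nonneg (x 0), sq_nonneg (x 1), sq_nonneg (x 2)]
  funext i
  fin_cases i <;> assumption

theorem contDiff_normSq3 : ContDiff ℝ ∞ normSq3 := by
  unfold normSq3
  fun_prop

theorem isSmooth_comp_normSq3 {ψ : ℝ → ℝ} (hψ : ContDiffOn ℝ ∞ ψ (Set.Ioi 0)) :
    IsSmooth (fun x : slΩ => ψ (normSq3 x.1)) :=
  isSmooth_of_eq (F := ψ ∘ normSq3) (hψ.comp contDiff_normSq3.contDiffOn fun _ hx => normSq3_pos hx)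
    fun _ => rfl

theorem fderiv_normSq3_apply (x v : Fin 3 → ℝ) :
    fderiv ℝ normSq3 x v = 2 * (x 0 * v 0 + x 1 * v 1 + x 2 * v 2) := by
  have h : ∀ i : Fin 3, HasFDerivAt (fun y : Fin 3 → ℝ => y i ^ 2)
      ((2 * x i) • (ContinuousLinearMap.proj i : (Fin 3 → ℝ) →L[ℝ] ℝ)) x := by
    intro i
    have := ((ContinuousLinearMap.proj i : (Fin 3 → ℝ) →L[ℝ] ℝ).hasFDerivAt (x := x)).pow 2
    simpa using this
  have := (((h 0).add (h 1)).add (h 2)).fderiv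
  have e : normSq3 = ((fun y : Fin 3 → ℝ => y 0 ^ 2) + fun y => y 1 ^ 2) + fun y => y 2 ^ 2 := rfl
  rw [e, this]
  simp
  ring

/-- H_{x₃} generates rotations about the x₃-axis, which preserve the Euclidean norm. -/
theorem slΛ_dCov_comp_normSq3 {ψ : ℝ → ℝ} (hψ : ContDiffOn ℝ ∞ ψ (Set.Ioi 0)) (x : slΩ) :
    slΛ x ![![0, 0, 1], dCov (fun x : slΩ => ψ (normSq3 x.1)) x] = 0 := by
  have hpos := normSq3_pos x.2
  have hd : DifferentiableAt ℝ ψ (normSq3 x.1) :=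
    (hψ.contDiffAt (Ioi_mem_nhds hpos)).differentiableAt (by simp)
  have hN : DifferentiableAt ℝ normSq3 x.1 := contDiff_normSq3.differentiable (by simp) _
  rw [diff_of_eq (f := fun x : slΩ => ψ (normSq3 x.1)) (F := ψ ∘ normSq3) fun _ => rfl,
    slΛ_apply, fderiv_comp _ hd hN]
  simp [fderiv_normSq3_apply]
  ring

theorem contDiffOn_rpow_inv (α : ℝ) : ContDiffOn ℝ ∞ (fun y : ℝ => 1 / y ^ α) (Set.Ioi 0) := by
  intro y hy
  have hy : 0 < y := hy
  refine ContDiffAt.contDiffWithinAt ?_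
  exact contDiffAt_const.div (Real.contDiffAt_rpow_const_of_ne hy.ne')
    (Real.rpow_pos_of_pos hy α).ne'

theorem contDiffOn_exp_div (α : ℝ) :
    ContDiffOn ℝ ∞ (fun y : ℝ => Real.exp (α / y) / y ^ 2) (Set.Ioi 0) := by
  intro y hy
  have hy : y ≠ 0 := ne_of_gt hy
  refine ContDiffAt.contDiffWithinAt ?_
  exact ((contDiffAt_const.div contDiffAt_id hy).exp).div (contDiffAt_id.pow 2) (pow_ne_zero 2 hy)

/-! ### The parameterization of the leaves and derivatives along it -/

theorem normSq3_param (p q z : ℝ) : normSq3 (param p q z) = 2 * p ^ 2 + z ^ 2 := by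
  simp [normSq3, param]
  linear_combination (p ^ 2 + z ^ 2) * Real.sin_sq_add_cos_sq q

theorem param_mem {p q z : ℝ} (h : p ≠ 0 ∨ z ≠ 0) : param p q z ∈ slΩ := by
  have hpos : 0 < normSq3 (param p q z) := by
    rw [normSq3_param]
    rcases h with h | h <;> positivity
  intro h0
  rw [Set.mem_singleton_iff] at h0
  rw [h0] at hpos
  simp [normSq3] at hpos

theorem continuous_param : Continuous fun t : ℝ × ℝ × ℝ => param t.1 t.2.1 t.2.2 := by
  refine continuous_pi fun i => ?_
  fin_cases i <;> simp [param] <;> fun_prop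

/-- The velocity `∂param/∂p`. -/
def velP (q : ℝ) : Fin 3 → ℝ := ![-Real.sin q, -Real.cos q, 1]

/-- The velocity `∂param/∂q`, which is the value of `H_{x₃}`. -/
def velQ (x : Fin 3 → ℝ) : Fin 3 → ℝ := ![x 1, -x 0, 0]

theorem hasDerivAt_param_p (p q z : ℝ) :
    HasDerivAt (fun p => param p q z) (velP q) p := by
  rw [hasDerivAt_pi]
  have h := hasDerivAt_id p
  intro i
  fin_cases i
  · simpa [param, velP] using (h.neg.mul_const (Real.sin q)).add_const (z * Real.cos q)
  · simpa [param, velP] using (h.neg.mul_const (Real.cos q)).sub_const (z * Real.sin q)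
  · simpa [param, velP] using hasDerivAt_id' p

theorem hasDerivAt_param_q (p q z : ℝ) :
    HasDerivAt (fun q => param p q z) (velQ (param p q z)) q := by
  rw [hasDerivAt_pi]
  have hs := Real.hasDerivAt_sin q
  have hc := Real.hasDerivAt_cos q
  intro i
  fin_cases i
  · have := (hs.const_mul (-p)).add (hc.const_mul z)
    refine (this.congr_deriv ?_)
    simp [param, velQ]
    ring
  · have := (hc.const_mul (-p)).sub (hs.const_mul z)
    refine (this.congr_deriv ?_)
    simp [param, velQ]
    ring
  · simpa [param, velQ] using hasDerivAt_const q p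

theorem fderiv_zeroExt_eq_dCov (f : slΩ → ℝ) (x : slΩ) (v : Fin 3 → ℝ) :
    fderiv ℝ (zeroExt f) x.1 v = v 0 * dCov f x 0 + v 1 * dCov f x 1 + v 2 * dCov f x 2 := by
  have hv : v = v 0 • Pi.single 0 1 + v 1 • Pi.single 1 1 + v 2 • Pi.single 2 1 := by
    funext i; fin_cases i <;> simp
  conv_lhs => rw [hv]
  simp only [map_add, map_smul, smul_eq_mul]
  rfl

theorem hasDerivAt_zeroExt_param_p {f : slΩ → ℝ} (hf : IsSmooth f) {p q z : ℝ}
    (h : param p q z ∈ slΩ) :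
    HasDerivAt (fun p => zeroExt f (param p q z))
      (fderiv ℝ (zeroExt f) (param p q z) (velP q)) p :=
  (hf.differentiableAt ⟨_, h⟩).hasFDerivAt.comp_hasDerivAt p (hasDerivAt_param_p p q z)

theorem hasDerivAt_zeroExt_param_q {f : slΩ → ℝ} (hf : IsSmooth f) {p q z : ℝ}
    (h : param p q z ∈ slΩ) :
    HasDerivAt (fun q => zeroExt f (param p q z))
      (fderiv ℝ (zeroExt f) (param p q z) (velQ (param p q z))) q :=
  (hf.differentiableAt ⟨_, h⟩).hasFDerivAt.comp_hasDerivAt q (hasDerivAt_param_q p q z)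

theorem continuous_zeroExt_param {X : Type*} [TopologicalSpace X] {f : slΩ → ℝ} (hf : IsSmooth f)
    {u : X → ℝ × ℝ × ℝ} (hu : Continuous u) (h : ∀ t, (u t).1 ≠ 0 ∨ (u t).2.2 ≠ 0) :
    Continuous fun t => zeroExt f (param (u t).1 (u t).2.1 (u t).2.2) :=
  hf.continuousOn.comp_continuous (continuous_param.comp hu) fun t => param_mem (h t)

theorem continuous_fderiv_zeroExt_param {f : slΩ → ℝ} (hf : IsSmooth f) {z : ℝ} (hz : z ≠ 0) :
    Continuous fun t : ℝ × ℝ => fderiv ℝ (zeroExt f) (param t.1 t.2 z) (velP t.2) := by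
  have h1 : Continuous fun t : ℝ × ℝ => fderiv ℝ (zeroExt f) (param t.1 t.2 z) :=
    (hf.continuousOn_fderiv_of_isOpen slΩ.isOpen (by simp)).comp_continuous
      (continuous_param.comp (by fun_prop : Continuous fun t : ℝ × ℝ => (t.1, t.2, z)))
      fun t => param_mem (Or.inr hz)
  have h2 : Continuous fun t : ℝ × ℝ => velP t.2 := by
    refine continuous_pi fun i => ?_
    fin_cases i <;> simp [velP] <;> fun_prop
  exact h1.clm_apply h2

/-! ### Casimir functions are constant on the leaves -/

theorem eq_zero_of_mul_sum_sq {x : slΩ} {t : ℝ} (h0 : x.1 0 * t = 0) (h1 : x.1 1 * t = 0)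
    (h2 : x.1 2 * t = 0) : t = 0 := by
  have h := (normSq3_pos x.2).ne'
  have : normSq3 x.1 * t = 0 := by
    unfold normSq3
    linear_combination x.1 0 * h0 + x.1 1 * h1 + x.1 2 * h2
  exact (mul_eq_zero.mp this).resolve_left h

/-- A covector annihilated by `Λ` at a point of a leaf vanishes on `∂/∂p`. -/
theorem velP_dot_eq_zero {p q z : ℝ} (h : param p q z ∈ slΩ) {v : Fin 3 → ℝ}
    (hv : ∀ η, slΛ ⟨param p q z, h⟩ ![η, v] = 0) :
    velP q 0 * v 0 + velP q 1 * v 1 + velP q 2 * v 2 = 0 := by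
  have h0 := hv ![1, 0, 0]
  have h1 := hv ![0, 1, 0]
  have h2 := hv ![0, 0, 1]
  have hsc := Real.sin_sq_add_cos_sq q
  simp [slΛ_apply, param] at h0 h1 h2
  -- Each coordinate of x times the pairing of v with the velocity is a combination of the values
  -- Λ(dxᵢ, v), and x ≠ 0. This avoids dividing by z.
  refine eq_zero_of_mul_sum_sq (x := ⟨_, h⟩) ?_ ?_ ?_ <;>
  simp only [param, velP, Matrix.cons_val_zero, Matrix.cons_val_one, Matrix.cons_val]
  · linear_combination h1 + Real.cos q * h2 + p * v 0 * hsc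
  · linear_combination -h0 - Real.sin q * h2 + p * v 1 * hsc
  · linear_combination -Real.sin q * h1 + Real.cos q * h0 - p * v 2 * hsc

/-- Both coordinate velocities ∂_p and ∂_q are tangent to the leaf, where the differential of a
Casimir vanishes, so its value depends on z only. -/
theorem casimir_param {c : FunRing slΩ} (hc : c ∈ casimirs slΛ) {z : ℝ} (hz : 0 < z)
    (p q p' q' : ℝ) : zeroExt c (param p q z) = zeroExt c (param p' q' z) := by
  have hm : ∀ p q, param p q z ∈ slΩ := fun p q => param_mem (Or.inr hz.ne')
  have hs : ∀ x η, slΛ x ![η, dCov c x] = 0 := fun x η => sharpDeriv_casimir hc η x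
  have hp : ∀ p, zeroExt c (param p q z) = zeroExt c (param p' q z) := by
    intro p
    refine is_const_of_deriv_eq_zero
      (fun p => (hasDerivAt_zeroExt_param_p hc.1 (hm p q)).differentiableAt) (fun p => ?_) p p'
    rw [(hasDerivAt_zeroExt_param_p hc.1 (hm p q)).deriv, fderiv_zeroExt_eq_dCov c ⟨_, hm p q⟩]
    exact velP_dot_eq_zero (hm p q) (hs _)
  rw [hp p]
  refine is_const_of_deriv_eq_zero
    (fun q => (hasDerivAt_zeroExt_param_q hc.1 (hm p' q)).differentiableAt) (fun q => ?_) q q'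
  rw [(hasDerivAt_zeroExt_param_q hc.1 (hm p' q)).deriv, fderiv_zeroExt_eq_dCov c ⟨_, hm p' q⟩]
  have := hs ⟨_, hm p' q⟩ ![0, 0, 1]
  simp [slΛ_apply] at this
  simp [velQ]
  linarith

/-! ### Limit obstructions -/

/-- The equation a H_{x₃} = σ f says that the covector a dx₃ + df annihilates the leaf. Evaluated on
the ruling direction, where dx₃ = 1, it gives ∂_p f = -a. -/
theorem limit_obstruction_degree_one {a f : slΩ → ℝ} (hf : IsSmooth f) (ha : IsSmooth a)
    (h : IsSigma slΛ (ofFun f) (aH3 a)) (q : ℝ) :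
    ∃ L : ℝ, Filter.Tendsto (fun z => ∫ s in (-1 : ℝ)..1, zeroExt a (param s q z))
      (𝓝[>] 0) (𝓝 L) := by
  have key : ∀ z : ℝ, 0 < z → ∫ s in (-1 : ℝ)..1, zeroExt a (param s q z)
      = zeroExt f (param (-1) q z) - zeroExt f (param 1 q z) := by
    intro z hz
    have hm : ∀ p, param p q z ∈ slΩ := fun p => param_mem (Or.inr hz.ne')
    have hd : ∀ p, HasDerivAt (fun p => -zeroExt f (param p q z))
        (zeroExt a (param p q z)) p := by
      intro p
      refine (hasDerivAt_zeroExt_param_p hf (hm p)).neg.congr_deriv ?_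
      set x : slΩ := ⟨_, hm p⟩ with hx
      rw [fderiv_zeroExt_eq_dCov f x]
      have hΛ : ∀ η, slΛ x ![η, a x • ![0, 0, 1] + dCov f x] = 0 := by
        intro η
        have h1 := h x ![η]
        rw [sigma_degree_zero, aH3_apply, lambda_skew] at h1
        rw [lambda_add, lambda_smul]
        have : slΛ x ![η, dCov f x] = a x * -slΛ x ![η, ![0, 0, 1]] := h1.symm
        rw [this]
        ring
      have h2 := velP_dot_eq_zero (hm p) hΛ
      have h3 : zeroExt a (param p q z) = a x := zeroExt_apply a x
      rw [h3]
      simp [velP] at h2 ⊢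
      linarith
    rw [intervalIntegral.integral_eq_sub_of_hasDerivAt (fun p _ => hd p)
      (Continuous.intervalIntegrable (continuous_zeroExt_param (u := fun s => (s, q, z)) ha
        (by fun_prop) fun _ => Or.inr hz.ne') _ _)]
    ring
  -- At z = 0 the endpoints p = ±1 lie on the cone away from the origin, so f is continuous there
  -- even though the ruling itself leaves Ω.
  refine ⟨zeroExt f (param (-1) q 0) - zeroExt f (param 1 q 0), ?_⟩
  have hcont : Continuous fun z => zeroExt f (param (-1) q z) - zeroExt f (param 1 q z) :=
    (continuous_zeroExt_param (u := fun z => (-1, q, z)) hf (by fun_prop)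
      fun _ => Or.inl (by norm_num)).sub
    (continuous_zeroExt_param (u := fun z => (1, q, z)) hf (by fun_prop)
      fun _ => Or.inl (by norm_num))
  refine ((hcont.tendsto 0).mono_left nhdsWithin_le_nhds).congr' ?_
  filter_upwards [self_mem_nhdsWithin] with z hz
  exact (key z hz).symm

/-- Stokes on the cylinder |p| ≤ 1 of the leaf, for φ = ∂_q G + ∂_p b. Integrating over a full turn
in q removes the periodic G and turns φ into 2πφ. Fubini then leaves the flux of b through p = ±1,
which is continuous up to z = 0. -/
theorem limit_of_exact_on_leaves {φ b : slΩ → ℝ} (hφ : IsSmooth φ) (hb : IsSmooth b)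
    (hinv : ∀ p q q' z : ℝ, 0 < z → zeroExt φ (param p q z) = zeroExt φ (param p q' z))
    (G : ℝ → ℝ → ℝ → ℝ) (hG : ∀ p z, G p (2 * Real.pi) z = G p 0 z)
    (hd : ∀ p q z : ℝ, 0 < z → HasDerivAt (fun q => G p q z)
      (zeroExt φ (param p q z) - fderiv ℝ (zeroExt b) (param p q z) (velP q)) q) (q : ℝ) :
    ∃ L : ℝ, Filter.Tendsto (fun z => ∫ s in (-1 : ℝ)..1, 2 * Real.pi * zeroExt φ (param s q z))
      (𝓝[>] 0) (𝓝 L) := by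
  have key : ∀ z : ℝ, 0 < z → ∫ s in (-1 : ℝ)..1, 2 * Real.pi * zeroExt φ (param s q z)
      = ∫ r in (0 : ℝ)..(2 * Real.pi), (zeroExt b (param 1 r z) - zeroExt b (param (-1) r z)) := by
    intro z hz
    have hm : ∀ p q, param p q z ∈ slΩ := fun p q => param_mem (Or.inr hz.ne')
    have hc := continuous_fderiv_zeroExt_param hb hz.ne'
    have h1 : ∀ s, 2 * Real.pi * zeroExt φ (param s q z)
        = ∫ r in (0 : ℝ)..(2 * Real.pi), fderiv ℝ (zeroExt b) (param s r z) (velP r) := by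
      intro s
      have hφc : Continuous fun r => zeroExt φ (param s r z) :=
        continuous_zeroExt_param (u := fun r => (s, r, z)) hφ (by fun_prop) fun _ => Or.inr hz.ne'
      have hbc : Continuous fun r => fderiv ℝ (zeroExt b) (param s r z) (velP r) :=
        hc.comp (by fun_prop : Continuous fun r : ℝ => (s, r))
      have h2 := intervalIntegral.integral_eq_sub_of_hasDerivAt (a := 0) (b := 2 * Real.pi)
        (fun r _ => hd s r z hz) ((hφc.sub hbc).intervalIntegrable _ _)
      rw [intervalIntegral.integral_sub (hφc.intervalIntegrable _ _)
        (hbc.intervalIntegrable _ _), hG, sub_self, sub_eq_zero] at h2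
      rw [← h2, intervalIntegral.integral_congr (g := fun _ => zeroExt φ (param s q z))
        fun r _ => hinv s r q z hz]
      simp
    simp only [h1]
    rw [MeasureTheory.intervalIntegral_intervalIntegral_swap]
    · refine intervalIntegral.integral_congr fun r _ => ?_
      exact intervalIntegral.integral_eq_sub_of_hasDerivAt
        (fun p _ => hasDerivAt_zeroExt_param_p hb (hm p r))
        ((hc.comp (by fun_prop : Continuous fun s : ℝ => (s, r))).intervalIntegrable _ _)
    · have : MeasureTheory.IntegrableOn
          (fun t : ℝ × ℝ => fderiv ℝ (zeroExt b) (param t.1 t.2 z) (velP t.2))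
          (Set.uIcc (-1) 1 ×ˢ Set.uIcc 0 (2 * Real.pi)) :=
        hc.continuousOn.integrableOn_compact (isCompact_uIcc.prod isCompact_uIcc)
      exact this.mono_set (Set.prod_mono Set.uIoc_subset_uIcc Set.uIoc_subset_uIcc)
  have hcont : Continuous fun z => ∫ r in (0 : ℝ)..(2 * Real.pi),
      (zeroExt b (param 1 r z) - zeroExt b (param (-1) r z)) := by
    refine intervalIntegral.continuous_parametric_intervalIntegral_of_continuous' ?_ _ _
    exact (continuous_zeroExt_param (u := fun t : ℝ × ℝ => (1, t.2, t.1)) hb (by fun_prop)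
      fun _ => Or.inl (by norm_num)).sub
      (continuous_zeroExt_param (u := fun t : ℝ × ℝ => (-1, t.2, t.1)) hb (by fun_prop)
      fun _ => Or.inl (by norm_num))
  refine ⟨_, ((hcont.tendsto 0).mono_left nhdsWithin_le_nhds).congr' ?_⟩
  filter_upwards [self_mem_nhdsWithin] with z hz
  exact (key z hz).symm

theorem param_two_pi (p z : ℝ) : param p (2 * Real.pi) z = param p 0 z := by
  simp [param]

/-- These are the Hamiltonian fields of the coordinates in Darboux form, H_g = (∂_p g) ∂_q - (∂_q g)
∂_p, using ∂_q x₁ = x₂ and ∂_q x₂ = -x₁. -/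
theorem slΛ_param {p q z : ℝ} (h : param p q z ∈ slΩ) (f : slΩ → ℝ) :
    slΛ ⟨_, h⟩ ![![1, 0, 0], dCov f ⟨_, h⟩] =
        -Real.sin q * fderiv ℝ (zeroExt f) (param p q z) (velQ (param p q z))
        - param p q z 1 * fderiv ℝ (zeroExt f) (param p q z) (velP q) ∧
      slΛ ⟨_, h⟩ ![![0, 1, 0], dCov f ⟨_, h⟩] =
        -Real.cos q * fderiv ℝ (zeroExt f) (param p q z) (velQ (param p q z))
        + param p q z 0 * fderiv ℝ (zeroExt f) (param p q z) (velP q) ∧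
      slΛ ⟨_, h⟩ ![![0, 0, 1], dCov f ⟨_, h⟩] =
        fderiv ℝ (zeroExt f) (param p q z) (velQ (param p q z)) := by
  have hf := fderiv_zeroExt_eq_dCov f ⟨_, h⟩
  simp only at hf
  have hsc := Real.sin_sq_add_cos_sq q
  simp only [hf, slΛ_apply]
  generalize dCov f ⟨_, h⟩ = d
  simp [param, velP, velQ]
  refine ⟨?_, ?_, by ring⟩
  · linear_combination p * d 1 * hsc
  · linear_combination -p * d 0 * hsc

theorem bivector_self_eq_zero (L : MultiVec 3 2) (ξ : Fin 3 → ℝ) : L ![ξ, ξ] = 0 :=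
  L.map_eq_zero_of_eq (i := 0) (j := 1) _ rfl (by decide)

theorem limit_obstruction_degree_two {φ : slΩ → ℝ} (hφ : IsSmooth φ)
    (hinv : ∀ p q q' z : ℝ, 0 < z → zeroExt φ (param p q z) = zeroExt φ (param p q' z))
    {B : MVField slΩ 1} (hB : IsSmoothField B) (h : IsSigma slΛ B (mulΛ φ)) (q : ℝ) :
    ∃ L : ℝ, Filter.Tendsto (fun z => ∫ s in (-1 : ℝ)..1, 2 * Real.pi * zeroExt φ (param s q z))
      (𝓝[>] 0) (𝓝 L) := by
  obtain ⟨b0, hb0⟩ : ∃ b : slΩ → ℝ, b = fun y => B y ![![1, 0, 0]] := ⟨_, rfl⟩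
  obtain ⟨b1, hb1⟩ : ∃ b : slΩ → ℝ, b = fun y => B y ![![0, 1, 0]] := ⟨_, rfl⟩
  obtain ⟨b2, hb2⟩ : ∃ b : slΩ → ℝ, b = fun y => B y ![![0, 0, 1]] := ⟨_, rfl⟩
  have h0 : IsSmooth b0 := hb0 ▸ hB _
  have h1 : IsSmooth b1 := hb1 ▸ hB _
  have h2 : IsSmooth b2 := hb2 ▸ hB _
  -- For B = B^p ∂_p + B^q ∂_q on the leaf, B(dx₃) = B^p, and solving B(dx₁), B(dx₂) for B^q gives
  -- the displayed quotient. The identity φ = ∂_q B^q + ∂_p B^p then needs only the (dx₃, dx₁) and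
  -- (dx₃, dx₂) components of the equation, so it persists for non-tangential B.
  refine limit_of_exact_on_leaves hφ h2 hinv
    (fun p q z => (param p q z 1 * zeroExt b0 (param p q z)
      - param p q z 0 * zeroExt b1 (param p q z) - z * zeroExt b2 (param p q z))
        / (p ^ 2 + z ^ 2)) ?_ ?_ q
  · intro p z
    simp only [param_two_pi]
  intro p q z hz
  have hm : param p q z ∈ slΩ := param_mem (Or.inr hz.ne')
  have hpz : p ^ 2 + z ^ 2 ≠ 0 := by positivity
  have hx := fun i => hasDerivAt_pi.mp (hasDerivAt_param_q p q z) i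
  refine (((((hx 1).mul (hasDerivAt_zeroExt_param_q h0 hm)).sub
    ((hx 0).mul (hasDerivAt_zeroExt_param_q h1 hm))).sub
    ((hasDerivAt_zeroExt_param_q h2 hm).const_mul z)).div_const (p ^ 2 + z ^ 2)).congr_deriv ?_
  rw [div_eq_iff hpz]
  have h01 := h ⟨_, hm⟩ ![![0, 0, 1], ![1, 0, 0]]
  have h02 := h ⟨_, hm⟩ ![![0, 0, 1], ![0, 1, 0]]
  rw [sigma_degree_one, formBracket_slΛ] at h01 h02
  have s1 : slBracket ![0, 0, 1] ![1, 0, 0] = ![0, 1, 0] := by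
    funext i; fin_cases i <;> simp [slBracket]
  have s2 : slBracket ![0, 0, 1] ![0, 1, 0] = (-1 : ℝ) • ![1, 0, 0] := by
    funext i; fin_cases i <;> simp [slBracket]
  have s3 : B ⟨_, hm⟩ ![(-1 : ℝ) • ![1, 0, 0]] = -1 * b0 ⟨_, hm⟩ := by
    rw [hb0]
    exact congrArg (fun L : MultiVec 3 0 => L ![])
      ((B ⟨_, hm⟩).curryLeft.map_smul (-1) ![1, 0, 0])
  have s4 : B ⟨_, hm⟩ ![![0, 1, 0]] = b1 ⟨_, hm⟩ := by rw [hb1]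
  change _ = slΛ _ ![![0, 0, 1], dCov (fun y => B y ![![1, 0, 0]]) _]
    - slΛ _ ![![1, 0, 0], dCov (fun y => B y ![![0, 0, 1]]) _]
    - B _ ![slBracket ![0, 0, 1] ![1, 0, 0]] at h01
  change _ = slΛ _ ![![0, 0, 1], dCov (fun y => B y ![![0, 1, 0]]) _]
    - slΛ _ ![![0, 1, 0], dCov (fun y => B y ![![0, 0, 1]]) _]
    - B _ ![slBracket ![0, 0, 1] ![0, 1, 0]] at h02
  rw [s1, s4, ← hb0, ← hb2, (slΛ_param hm b0).2.2, (slΛ_param hm b2).1, mulΛ_apply, slΛ_apply,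
    ← zeroExt_apply φ, ← zeroExt_apply b1] at h01
  rw [s2, s3, ← hb1, ← hb2, (slΛ_param hm b1).2.2, (slΛ_param hm b2).2.1, mulΛ_apply, slΛ_apply,
    ← zeroExt_apply φ, ← zeroExt_apply b0] at h02
  have hr : param p q z 0 ^ 2 + param p q z 1 ^ 2 = p ^ 2 + z ^ 2 := by
    simp [param]
    linear_combination (p ^ 2 + z ^ 2) * Real.sin_sq_add_cos_sq q
  have hsc : param p q z 1 * Real.sin q - param p q z 0 * Real.cos q = -z := by
    simp [param]
    linear_combination -z * Real.sin_sq_add_cos_sq q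
  rw [← hr]
  simp [velQ] at h01 h02 ⊢
  linear_combination -param p q z 1 * h01 + param p q z 0 * h02
    - fderiv ℝ (zeroExt b2) (param p q z) ![param p q z 1, -param p q z 0, 0] * hsc

theorem limit_obstruction_degree_three {φ : slΩ → ℝ} (hφ : IsSmooth φ)
    (hinv : ∀ p q q' z : ℝ, 0 < z → zeroExt φ (param p q z) = zeroExt φ (param p q' z))
    {P : MVField slΩ 2} (hP : IsSmoothField P) (h : IsSigma slΛ P (mulVol φ)) (q : ℝ) :
    ∃ L : ℝ, Filter.Tendsto (fun z => ∫ s in (-1 : ℝ)..1, 2 * Real.pi * zeroExt φ (param s q z))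
      (𝓝[>] 0) (𝓝 L) := by
  obtain ⟨v0, hv0⟩ : ∃ b : slΩ → ℝ, b = fun y => P y ![![0, 0, 1], ![0, 1, 0]] := ⟨_, rfl⟩
  obtain ⟨v1, hv1⟩ : ∃ b : slΩ → ℝ, b = fun y => P y ![![0, 0, 1], ![1, 0, 0]] := ⟨_, rfl⟩
  obtain ⟨v2, hv2⟩ : ∃ b : slΩ → ℝ, b = fun y => P y ![![1, 0, 0], ![0, 1, 0]] := ⟨_, rfl⟩
  have h0 : IsSmooth v0 := hv0 ▸ hP _
  have h1 : IsSmooth v1 := hv1 ▸ hP _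
  have h2 : IsSmooth v2 := hv2 ▸ hP _
  have hcoord : ∀ i : Fin 3, IsSmooth fun y : slΩ => y.1 i := fun i => by
    simpa using isSmooth_dotProduct (Pi.single i 1)
  have hb : IsSmooth fun y : slΩ => y.1 0 * v1 y + y.1 1 * v0 y :=
    ((hcoord 0).mul h1).add ((hcoord 1).mul h0)
  -- All bracket terms of σP(dx₃, dx₁, dx₂) have the form P(ξ, ξ) = 0, so φ = H_{x₃} v₂ - H_{x₁} v₀
  -- + H_{x₂} v₁. Grouping the ∂_q and ∂_p parts gives G and b; the terms from differentiating sin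
  -- q, cos q against ∂_p x₁ = -sin q, ∂_p x₂ = -cos q cancel.
  refine limit_of_exact_on_leaves hφ hb hinv
    (fun p q z => Real.sin q * zeroExt v0 (param p q z) - Real.cos q * zeroExt v1 (param p q z)
      + zeroExt v2 (param p q z)) ?_ ?_ q
  · intro p z
    simp only [param_two_pi]
    simp
  intro p q z hz
  have hm : param p q z ∈ slΩ := param_mem (Or.inr hz.ne')
  refine ((((Real.hasDerivAt_sin q).mul (hasDerivAt_zeroExt_param_q h0 hm)).sub
    ((Real.hasDerivAt_cos q).mul (hasDerivAt_zeroExt_param_q h1 hm))).add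
    (hasDerivAt_zeroExt_param_q h2 hm)).congr_deriv ?_
  have h012 := h ⟨_, hm⟩ ![![0, 0, 1], ![1, 0, 0], ![0, 1, 0]]
  rw [sigma_degree_two] at h012
  change _ = slΛ _ ![![0, 0, 1], dCov (fun y => P y ![![1, 0, 0], ![0, 1, 0]]) _]
    - slΛ _ ![![1, 0, 0], dCov (fun y => P y ![![0, 0, 1], ![0, 1, 0]]) _]
    + slΛ _ ![![0, 1, 0], dCov (fun y => P y ![![0, 0, 1], ![1, 0, 0]]) _]
    - P _ ![formBracket slΛ ![0, 0, 1] ![1, 0, 0] _, ![0, 1, 0]]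
    + P _ ![formBracket slΛ ![0, 0, 1] ![0, 1, 0] _, ![1, 0, 0]]
    - P _ ![formBracket slΛ ![1, 0, 0] ![0, 1, 0] _, ![0, 0, 1]] at h012
  have s1 : slBracket ![0, 0, 1] ![1, 0, 0] = ![0, 1, 0] := by
    funext i; fin_cases i <;> simp [slBracket]
  have s2 : slBracket ![0, 0, 1] ![0, 1, 0] = (-1 : ℝ) • ![1, 0, 0] := by
    funext i; fin_cases i <;> simp [slBracket]
  have s3 : slBracket ![1, 0, 0] ![0, 1, 0] = (-1 : ℝ) • ![0, 0, 1] := by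
    funext i; fin_cases i <;> simp [slBracket]
  rw [formBracket_slΛ, formBracket_slΛ, formBracket_slΛ, s1, s2, s3, bivector_self_eq_zero,
    lambda_skew (Λ := P) _ (_ • _), lambda_smul, bivector_self_eq_zero,
    lambda_skew (Λ := P) _ (_ • _), lambda_smul, bivector_self_eq_zero, ← hv0, ← hv1, ← hv2,
    (slΛ_param hm v0).1, (slΛ_param hm v1).2.1, (slΛ_param hm v2).2.2, mulVol_apply,
    ← zeroExt_apply φ] at h012
  have e : dCov (fun y : slΩ => y.1 0 * v1 y + y.1 1 * v0 y) ⟨_, hm⟩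
      = param p q z 0 • dCov v1 ⟨_, hm⟩ + v1 ⟨_, hm⟩ • Pi.single 0 1
        + (param p q z 1 • dCov v0 ⟨_, hm⟩ + v0 ⟨_, hm⟩ • Pi.single 1 1) := by
    rw [diff_add ((hcoord 0).mul h1) ((hcoord 1).mul h0), diff_mul (hcoord 0) h1,
      diff_mul (hcoord 1) h0, slCoord_dCov, slCoord_dCov]
  have e' : fderiv ℝ (zeroExt fun y : slΩ => y.1 0 * v1 y + y.1 1 * v0 y) (param p q z) (velP q)
      = param p q z 0 * fderiv ℝ (zeroExt v1) (param p q z) (velP q)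
        + param p q z 1 * fderiv ℝ (zeroExt v0) (param p q z) (velP q)
        - Real.sin q * zeroExt v1 (param p q z) - Real.cos q * zeroExt v0 (param p q z) := by
    rw [fderiv_zeroExt_eq_dCov _ ⟨_, hm⟩, fderiv_zeroExt_eq_dCov v1 ⟨_, hm⟩,
      fderiv_zeroExt_eq_dCov v0 ⟨_, hm⟩, e, zeroExt_apply v1 ⟨_, hm⟩, zeroExt_apply v0 ⟨_, hm⟩]
    simp [velP]
    ring
  rw [e']
  simp at h012
  linear_combination -h012

/-! ### Asymptotics of integrals along the leaves -/

/-- Let T be the term of largest index with nonzero germ. Every other term is o(T), and the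
convergent total is o(T) because |T| → ∞. Hence T = o(T), which is absurd. -/
theorem eventuallyEq_zero_of_tendsto_sum {ι : Type*} [LinearOrder ι] {l : Filter ℝ} [l.NeBot]
    {s : Finset ι} {c F : ι → ℝ → ℝ} (hc : ∀ i ∈ s, c i =O[l] fun _ => (1 : ℝ))
    (hdom : ∀ i ∈ s, c i =ᶠ[l] 0 ∨ (Filter.Tendsto (fun z => ‖c i z * F i z‖) l Filter.atTop ∧
      ∀ j ∈ s, j < i → F j =o[l] fun z => c i z * F i z))
    {L : ℝ} (h : Filter.Tendsto (fun z => ∑ i ∈ s, c i z * F i z) l (𝓝 L)) :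
    ∀ i ∈ s, c i =ᶠ[l] 0 := by
  classical
  by_contra! hne
  obtain ⟨i₀, hi₀, hi₀'⟩ := hne
  set t := s.filter fun i => ¬ c i =ᶠ[l] 0 with ht
  have htne : t.Nonempty := ⟨i₀, by simp [ht, hi₀, hi₀']⟩
  set i := t.max' htne with hi
  have hit : i ∈ t := t.max'_mem htne
  have his : i ∈ s := (Finset.mem_filter.mp hit).1
  obtain ⟨htop, hlt⟩ := (hdom i his).resolve_left (Finset.mem_filter.mp hit).2
  set T : ℝ → ℝ := fun z => c i z * F i z with hT
  have hrest : (fun z => ∑ j ∈ s.erase i, c j z * F j z) =o[l] T := by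
    refine Asymptotics.IsLittleO.fun_sum fun j hj => ?_
    have hjs := Finset.mem_of_mem_erase hj
    by_cases hj0 : c j =ᶠ[l] 0
    · refine (Asymptotics.isLittleO_zero T l).congr' ?_ Filter.EventuallyEq.rfl
      filter_upwards [hj0] with z hz
      simp [hz]
    · have hjt : j ∈ t := by simp [ht, hjs, hj0]
      have hji : j < i := lt_of_le_of_ne (t.le_max' j hjt) (Finset.ne_of_mem_erase hj)
      simpa using (hc j hjs).mul_isLittleO (hlt j hjs hji)
  have hsum : (fun z => ∑ j ∈ s, c j z * F j z) =o[l] T :=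
    (h.isBigO_one ℝ).trans_isLittleO (Asymptotics.isLittleO_one_left_iff ℝ |>.mpr htop)
  have hTT : T =o[l] T := by
    refine (hsum.sub hrest).congr_left fun z => ?_
    rw [← Finset.add_sum_erase s _ his]
    simp [hT]
  have hfreq : ∃ᶠ z in l, T z ≠ 0 := by
    refine (htop.eventually_gt_atTop 0).frequently.mono fun z hz => ?_
    exact norm_pos_iff.mp hz
  exact Asymptotics.isLittleO_irrefl (hfreq.mono fun z hz => hz) hTT

/-- The integral of `ψ(x₁² + x₂² + x₃²)` along a curve `p ↦ param p q z`, `|p| ≤ 1`. -/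
def leafIntegral (ψ : ℝ → ℝ) (z : ℝ) : ℝ := ∫ s in (-1 : ℝ)..1, ψ (2 * s ^ 2 + z ^ 2)

theorem continuous_leaf {ψ : ℝ → ℝ} (hψ : ContinuousOn ψ (Set.Ioi 0)) {z : ℝ} (hz : 0 < z) :
    Continuous fun s => ψ (2 * s ^ 2 + z ^ 2) :=
  hψ.comp_continuous (by fun_prop) fun s => by
    rw [Set.mem_Ioi]
    positivity

theorem leafIntegral_le {ψ : ℝ → ℝ} (hψ : ContinuousOn ψ (Set.Ioi 0))
    (ha : AntitoneOn ψ (Set.Ioi 0)) {z : ℝ} (hz : 0 < z) :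
    leafIntegral ψ z ≤ 2 * ψ (z ^ 2) := by
  have h : leafIntegral ψ z ≤ ∫ _ in (-1 : ℝ)..1, ψ (z ^ 2) := by
    refine intervalIntegral.integral_mono_on (by norm_num)
      ((continuous_leaf hψ hz).intervalIntegrable _ _) (by simp) fun s _ => ?_
    refine ha (Set.mem_Ioi.mpr (by positivity)) (Set.mem_Ioi.mpr (by positivity)) ?_
    nlinarith [sq_nonneg s]
  refine h.trans_eq ?_
  rw [intervalIntegral.integral_const, smul_eq_mul]
  norm_num

/-- Only the piece 0 ≤ s ≤ δz is kept. There the argument is at most (1 + 2δ²)z², so a small δ costs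
only a factor z while bringing the argument close to its minimum z². -/
theorem le_leafIntegral {ψ : ℝ → ℝ} (hψ : ContinuousOn ψ (Set.Ioi 0))
    (ha : AntitoneOn ψ (Set.Ioi 0)) (h0 : ∀ y, 0 < y → 0 ≤ ψ y) {z δ : ℝ} (hz : 0 < z)
    (hz1 : z ≤ 1) (hδ : 0 < δ) (hδ1 : δ ≤ 1) :
    δ * z * ψ ((1 + 2 * δ ^ 2) * z ^ 2) ≤ leafIntegral ψ z := by
  have hc := continuous_leaf hψ hz
  have hδz : δ * z ≤ 1 := by nlinarith
  have hδz0 : 0 < δ * z := by positivity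
  calc δ * z * ψ ((1 + 2 * δ ^ 2) * z ^ 2)
      = ∫ _ in (0 : ℝ)..(δ * z), ψ ((1 + 2 * δ ^ 2) * z ^ 2) := by simp
    _ ≤ ∫ s in (0 : ℝ)..(δ * z), ψ (2 * s ^ 2 + z ^ 2) := by
      refine intervalIntegral.integral_mono_on hδz0.le (by simp) (hc.intervalIntegrable _ _)
        fun s hs => ?_
      refine ha (Set.mem_Ioi.mpr (by positivity)) (Set.mem_Ioi.mpr (by positivity)) ?_
      have : s ^ 2 ≤ (δ * z) ^ 2 := pow_le_pow_left₀ hs.1 hs.2 2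
      nlinarith
    _ ≤ leafIntegral ψ z := by
      refine intervalIntegral.integral_mono_interval (by norm_num) hδz0.le hδz
        (Filter.Eventually.of_forall fun s => h0 _ (by positivity)) (hc.intervalIntegrable _ _)

theorem antitoneOn_rpow_inv {α : ℝ} (hα : 0 ≤ α) :
    AntitoneOn (fun y : ℝ => 1 / y ^ α) (Set.Ioi 0) := by
  intro a ha b _ hab
  have ha : 0 < a := ha
  exact one_div_le_one_div_of_le (Real.rpow_pos_of_pos ha α)
    (Real.rpow_le_rpow ha.le hab hα)

theorem antitoneOn_exp_div {α : ℝ} (hα : 0 ≤ α) :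
    AntitoneOn (fun y : ℝ => Real.exp (α / y) / y ^ 2) (Set.Ioi 0) := by
  intro a ha b _ hab
  have ha : 0 < a := ha
  dsimp only
  gcongr

theorem tendsto_leafIntegral_rpow_atTop {α : ℝ} (hα : 1 / 2 < α) :
    Filter.Tendsto (leafIntegral fun y => 1 / y ^ α) (𝓝[>] 0) Filter.atTop := by
  have h1 : Filter.Tendsto (fun z : ℝ => (1 / 3 ^ α) * (z⁻¹) ^ (2 * α - 1)) (𝓝[>] 0)
      Filter.atTop :=
    ((tendsto_rpow_atTop (by linarith)).comp tendsto_inv_nhdsGT_zero).const_mul_atTop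
      (by positivity)
  refine Filter.tendsto_atTop_mono' _ ?_ h1
  filter_upwards [Ioc_mem_nhdsGT (zero_lt_one' ℝ)] with z hz
  -- With δ = 1 the lower bound is z · (3z²)^(-α) = 3^(-α) z^(1-2α), which diverges exactly because
  -- α > 1/2.
  refine le_trans (le_of_eq ?_) (le_leafIntegral (contDiffOn_rpow_inv α).continuousOn
    (antitoneOn_rpow_inv (by linarith)) (fun y hy => by positivity) hz.1 hz.2 one_pos le_rfl)
  have hz := hz.1
  have e : (1 + 2 * (1 : ℝ) ^ 2) * z ^ 2 = 3 * z ^ (2 : ℝ) := by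
    rw [Real.rpow_two]; ring
  rw [e, Real.mul_rpow (by norm_num) (by positivity), ← Real.rpow_mul hz.le,
    Real.inv_rpow hz.le, Real.rpow_sub hz, Real.rpow_one]
  field_simp

theorem leafIntegral_rpow_isLittleO {β α : ℝ} (hβ : 0 < β) (hβα : β < α) (hα : 1 / 2 < α) :
    (leafIntegral fun y => 1 / y ^ β) =o[𝓝[>] 0] leafIntegral fun y => 1 / y ^ α := by
  have hα0 : 0 < α := hβ.trans hβα
  have key : ∀ ε : ℝ, 0 < ε → ∃ C : ℝ, ∀ y : ℝ, 0 < y → 1 / y ^ β ≤ ε * (1 / y ^ α) + C := by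
    intro ε hε
    -- The crossover point where y^(-β) = ε y^(-α): below it the α-power wins, above it y^(-β) is
    -- bounded.
    set y₀ := ε ^ (1 / (α - β)) with hy₀
    have hy₀pos : 0 < y₀ := Real.rpow_pos_of_pos hε _
    refine ⟨1 / y₀ ^ β, fun y hy => ?_⟩
    rcases le_total y y₀ with h | h
    · have h1 : y ^ (α - β) ≤ ε := by
        calc y ^ (α - β) ≤ y₀ ^ (α - β) := Real.rpow_le_rpow hy.le h (by linarith)
          _ = ε := by
            rw [hy₀, ← Real.rpow_mul hε.le, one_div_mul_cancel (by linarith), Real.rpow_one]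
      have h2 : 1 / y ^ β = y ^ (α - β) * (1 / y ^ α) := by
        rw [Real.rpow_sub hy]
        field_simp
      rw [h2]
      have : 0 ≤ 1 / y₀ ^ β := by positivity
      have := mul_le_mul_of_nonneg_right h1 (by positivity : 0 ≤ 1 / y ^ α)
      linarith
    · have := antitoneOn_rpow_inv hβ.le (Set.mem_Ioi.mpr hy₀pos) (Set.mem_Ioi.mpr hy) h
      simp only at this
      have : 0 ≤ ε * (1 / y ^ α) := by positivity
      linarith
  rw [Asymptotics.isLittleO_iff]
  intro ε hε
  obtain ⟨C, hC⟩ := key (ε / 2) (by positivity)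
  -- Since the α-integral diverges, the constant 2C coming from an interval of length 2 is
  -- eventually at most half of ε times it; the other half is the factor ε / 2 already chosen.
  filter_upwards [self_mem_nhdsWithin,
    (tendsto_leafIntegral_rpow_atTop hα).eventually_ge_atTop (max 0 (2 * (2 * C) / ε))] with z hz hT
  have hz : 0 < z := hz
  have hcβ := continuous_leaf (contDiffOn_rpow_inv β).continuousOn hz
  have hcα := continuous_leaf (contDiffOn_rpow_inv α).continuousOn hz
  have h1 : leafIntegral (fun y => 1 / y ^ β) z
      ≤ ε / 2 * leafIntegral (fun y => 1 / y ^ α) z + 2 * C := by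
    have : leafIntegral (fun y => 1 / y ^ β) z
        ≤ ∫ s in (-1 : ℝ)..1, (ε / 2 * (1 / (2 * s ^ 2 + z ^ 2) ^ α) + C) :=
      intervalIntegral.integral_mono_on (by norm_num) (hcβ.intervalIntegrable _ _)
        (((hcα.const_mul _).add continuous_const).intervalIntegrable _ _)
        fun s _ => hC _ (by positivity)
    refine this.trans_eq ?_
    rw [intervalIntegral.integral_add ((hcα.const_mul _).intervalIntegrable _ _) (by simp),
      intervalIntegral.integral_const_mul, intervalIntegral.integral_const, leafIntegral]
    norm_num
  have h2 : 0 ≤ leafIntegral (fun y => 1 / y ^ β) z :=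
    intervalIntegral.integral_nonneg (by norm_num) fun s _ => by positivity
  rw [Real.norm_of_nonneg h2, Real.norm_of_nonneg ((le_max_left _ _).trans hT)]
  have h3 := (le_max_right _ _).trans hT
  rw [div_le_iff₀ hε] at h3
  linarith

theorem tendsto_pow_inv_mul_exp_neg {γ : ℝ} (hγ : 0 < γ) (m : ℕ) :
    Filter.Tendsto (fun z : ℝ => (z⁻¹) ^ (m + 1) * Real.exp (-(γ / z ^ 2))) (𝓝[>] 0) (𝓝 0) := by
  have h1 : Filter.Tendsto (fun z : ℝ => γ * (z⁻¹) ^ 2) (𝓝[>] 0) Filter.atTop :=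
    ((Filter.tendsto_pow_atTop two_ne_zero).comp tendsto_inv_nhdsGT_zero).const_mul_atTop hγ
  have h2 := ((Real.tendsto_pow_mul_exp_neg_atTop_nhds_zero (m + 1)).comp h1).const_mul
    ((γ⁻¹) ^ (m + 1))
  rw [mul_zero] at h2
  refine squeeze_zero' ?_ ?_ h2
  · filter_upwards [self_mem_nhdsWithin] with z hz
    have hz : 0 < z := hz
    positivity
  -- For z ≤ 1 one has z⁻¹ ≤ z⁻², which reduces to powers of u = γ z⁻² against exp(-u).
  · filter_upwards [Ioc_mem_nhdsGT (zero_lt_one' ℝ)] with z hz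
    have h3 : 1 ≤ z⁻¹ := (one_le_inv₀ hz.1).mpr hz.2
    have e1 : γ / z ^ 2 = γ * (z⁻¹) ^ 2 := by rw [inv_pow]; rfl
    simp only [Function.comp]
    rw [e1, ← mul_assoc, ← mul_pow, inv_mul_cancel_left₀ hγ.ne']
    gcongr
    nlinarith

/-- The β-integral is at most 2 exp(β/z²)/z⁴, and the α-integral is at least of order z
exp(α/(Dz²))/z⁴. Once δ is small enough that α/D > β, the exponential gap beats every power of z. -/
theorem leafIntegral_exp_isLittleO {β α : ℝ} (hβ : 0 ≤ β) (hβα : β < α) (m : ℕ) :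
    (leafIntegral fun y => Real.exp (β / y) / y ^ 2) =o[𝓝[>] 0]
      fun z => z ^ m * leafIntegral (fun y => Real.exp (α / y) / y ^ 2) z := by
  have hα : 0 < α := hβ.trans_lt hβα
  obtain ⟨δ, hδ, hδ1, hδα⟩ : ∃ δ : ℝ, 0 < δ ∧ δ ≤ 1 ∧ β < α / (1 + 2 * δ ^ 2) := by
    have hcont : Filter.Tendsto (fun δ : ℝ => α / (1 + 2 * δ ^ 2)) (𝓝[>] 0) (𝓝 α) := by
      have : Continuous fun δ : ℝ => α / (1 + 2 * δ ^ 2) :=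
        Continuous.div (by fun_prop) (by fun_prop) fun δ => by positivity
      simpa using (this.tendsto 0).mono_left nhdsWithin_le_nhds
    obtain ⟨δ, h1, h2⟩ := ((hcont.eventually_const_lt hβα).and
      (Ioc_mem_nhdsGT (zero_lt_one' ℝ))).exists
    exact ⟨δ, h2.1, h2.2, h1⟩
  set D := 1 + 2 * δ ^ 2 with hD
  have hDpos : 0 < D := by positivity
  set γ := α / D - β with hγdef
  have hγ : 0 < γ := by linarith
  rw [Asymptotics.isLittleO_iff]
  intro ε hε
  have hsmall := ((tendsto_pow_inv_mul_exp_neg hγ m).const_mul (2 * D ^ 2 / δ)).eventually_lt_const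
    (by simpa using hε)
  filter_upwards [hsmall, Ioc_mem_nhdsGT (zero_lt_one' ℝ)] with z hz1 hz
  have hz0 := hz.1
  have hup := leafIntegral_le (contDiffOn_exp_div β).continuousOn (antitoneOn_exp_div hβ) hz.1
  have hlow := le_leafIntegral (contDiffOn_exp_div α).continuousOn (antitoneOn_exp_div hα.le)
    (fun y hy => by positivity) hz.1 hz.2 hδ hδ1
  rw [← hD] at hlow
  have hnn : 0 ≤ leafIntegral (fun y => Real.exp (β / y) / y ^ 2) z :=
    intervalIntegral.integral_nonneg (by norm_num) fun s _ => by positivity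
  have hlow0 : 0 ≤ δ * z * (Real.exp (α / (D * z ^ 2)) / (D * z ^ 2) ^ 2) := by positivity
  rw [Real.norm_of_nonneg hnn,
    Real.norm_of_nonneg (mul_nonneg (by positivity) (hlow0.trans hlow))]
  have hexp : Real.exp (β / z ^ 2)
      = Real.exp (-(γ / z ^ 2)) * Real.exp (α / (D * z ^ 2)) := by
    rw [← Real.exp_add, hγdef]
    congr 1
    field_simp
    ring
  have e : 2 * (Real.exp (β / z ^ 2) / (z ^ 2) ^ 2)
      = (2 * D ^ 2 / δ * ((z⁻¹) ^ (m + 1) * Real.exp (-(γ / z ^ 2)))) *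
        (z ^ m * (δ * z * (Real.exp (α / (D * z ^ 2)) / (D * z ^ 2) ^ 2))) := by
    have hzm : z⁻¹ ^ (m + 1) * (z ^ m * z) = 1 := by
      rw [← pow_succ, ← mul_pow, inv_mul_cancel₀ hz0.ne', one_pow]
    rw [hexp]
    calc _ = (z⁻¹ ^ (m + 1) * (z ^ m * z)) * (2 * (Real.exp (-(γ / z ^ 2)) *
          Real.exp (α / (D * z ^ 2)) / (z ^ 2) ^ 2)) := by rw [hzm, one_mul]
      _ = _ := by
        field_simp
  calc _ ≤ _ := hup
    _ = _ := e
    _ ≤ ε * (z ^ m * leafIntegral (fun y => Real.exp (α / y) / y ^ 2) z) := by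
      gcongr

theorem tendsto_pow_mul_leafIntegral_exp_atTop {α : ℝ} (hα : 0 < α) (m : ℕ) :
    Filter.Tendsto (fun z => z ^ m * leafIntegral (fun y => Real.exp (α / y) / y ^ 2) z) (𝓝[>] 0)
      Filter.atTop := by
  -- Comparison with exponent 0, whose leaf integral is at least 1/9 for z ≤ 1.
  have h := leafIntegral_exp_isLittleO le_rfl hα m
  have hone : (fun _ => (1 : ℝ)) =o[𝓝[>] 0]
      fun z => z ^ m * leafIntegral (fun y => Real.exp (α / y) / y ^ 2) z := by
    refine Asymptotics.IsBigO.trans_isLittleO ?_ h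
    refine Asymptotics.IsBigO.of_bound 9 ?_
    filter_upwards [Ioc_mem_nhdsGT (zero_lt_one' ℝ)] with z hz
    have hlow := le_leafIntegral (contDiffOn_exp_div 0).continuousOn (antitoneOn_exp_div le_rfl)
      (fun y hy => by positivity) hz.1 hz.2 one_pos le_rfl
    have hz0 := hz.1
    have h1 : 1 / 9 ≤ 1 * z * (Real.exp (0 / ((1 + 2 * 1 ^ 2) * z ^ 2))
        / ((1 + 2 * 1 ^ 2) * z ^ 2) ^ 2) := by
      rw [zero_div, Real.exp_zero, one_mul, mul_one_div, div_le_div_iff₀ (by norm_num)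
        (by positivity)]
      have : z ^ 3 ≤ 1 := pow_le_one₀ hz0.le hz.2
      nlinarith
    have h2 := h1.trans hlow
    rw [Real.norm_of_nonneg (le_trans (by norm_num) h2)]
    rw [norm_one]
    linarith
  have h2 := (Asymptotics.isLittleO_one_left_iff ℝ).mp hone
  refine h2.congr' ?_
  filter_upwards [self_mem_nhdsWithin] with z hz
  have hz : 0 < z := hz
  refine Real.norm_of_nonneg (mul_nonneg (by positivity) ?_)
  exact intervalIntegral.integral_nonneg (by norm_num) fun s _ => by positivity

/-! ### Invariant analytic functions -/

theorem exists_cos_sin_eq {a b : ℝ} (h : a ^ 2 + b ^ 2 = 1) :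
    ∃ θ : ℝ, Real.cos θ = a ∧ Real.sin θ = b := by
  have hn : ‖(⟨a, b⟩ : ℂ)‖ = 1 := by
    rw [Complex.norm_eq_sqrt_sq_add_sq, h, Real.sqrt_one]
  have h0 : (⟨a, b⟩ : ℂ) ≠ 0 := by
    intro h0
    rw [h0] at hn
    simp at hn
  exact ⟨Complex.arg ⟨a, b⟩, by rw [Complex.cos_arg h0, hn, div_one],
    by rw [Complex.sin_arg, hn, div_one]⟩

theorem exists_param_eq {x : Fin 3 → ℝ} {z : ℝ} (hz : 0 < z)
    (h : x 0 ^ 2 + x 1 ^ 2 - x 2 ^ 2 = z ^ 2) : ∃ q, x = param (x 2) q z := by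
  set p := x 2
  have hr : p ^ 2 + z ^ 2 ≠ 0 := by positivity
  -- Cramer's rule for the linear system that `param` gives for cos q and sin q; its determinant is
  -- nonzero because p² + z² > 0.
  obtain ⟨q, hc, hs⟩ := exists_cos_sin_eq (a := (x 0 * z - x 1 * p) / (p ^ 2 + z ^ 2))
    (b := -(x 0 * p + x 1 * z) / (p ^ 2 + z ^ 2)) (by
      field_simp
      linear_combination (p ^ 2 + z ^ 2) * h)
  refine ⟨q, ?_⟩
  funext i
  fin_cases i
  · simp only [param, hc, hs]
    simp
    field_simp
    ring
  · simp only [param, hc, hs]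
    simp
    field_simp
    ring
  · rfl

/-- Constancy on leaves spreads the vanishing for small z > 0 to a whole region 0 < x₁² + x₂² - x₃²
< ε², and the identity theorem on ℝ³ does the rest. -/
theorem invAnalytic_eq_zero {c : casimirs slΛ} (hc : c ∈ invAnalytic)
    (h : (fun z => zeroExt c.1 (param 0 0 z)) =ᶠ[𝓝[>] 0] 0) : c = 0 := by
  obtain ⟨F, hF, -, hcF⟩ := hc
  obtain ⟨ε, hε, hzero⟩ := mem_nhdsGT_iff_exists_Ioo_subset.mp h
  have hε : 0 < ε := hε
  have hnear : F =ᶠ[𝓝 (![ε / 2, 0, 0] : Fin 3 → ℝ)] 0 := by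
    have hopen : IsOpen {x : Fin 3 → ℝ | 0 < x 0 ^ 2 + x 1 ^ 2 - x 2 ^ 2 ∧
        x 0 ^ 2 + x 1 ^ 2 - x 2 ^ 2 < ε ^ 2} :=
      IsOpen.and (isOpen_lt (by fun_prop) (by fun_prop)) (isOpen_lt (by fun_prop) (by fun_prop))
    refine Filter.eventually_of_mem (hopen.mem_nhds ?_) fun x hx => ?_
    · simp only [Set.mem_ofPred_eq, Matrix.cons_val_zero, Matrix.cons_val_one, Matrix.cons_val]
      constructor <;> nlinarith
    · obtain ⟨h1, h2⟩ := hx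
      set z := Real.sqrt (x 0 ^ 2 + x 1 ^ 2 - x 2 ^ 2)
      have hz : 0 < z := Real.sqrt_pos.mpr h1
      have hzε : z < ε := (Real.sqrt_lt' hε).mpr h2
      obtain ⟨q, hq⟩ := exists_param_eq hz (Real.sq_sqrt h1.le).symm
      have hm : x ∈ slΩ := hq ▸ param_mem (Or.inr hz.ne')
      have h3 : F x = zeroExt c.1 x := by rw [← hcF ⟨x, hm⟩, zeroExt_apply c.1 ⟨x, hm⟩]
      rw [h3, hq, casimir_param c.2 hz _ _ 0 0]
      exact hzero ⟨hz, hzε⟩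
  have h0 := hF.eqOn_of_preconnected_of_eventuallyEq (g := 0) analyticOnNhd_const
    isPreconnected_univ (Set.mem_univ _) hnear
  refine Subtype.ext (funext fun x => ?_)
  rw [hcF x, h0 (Set.mem_univ _)]
  rfl

/-! ### Convergent combinations of leaf integrals with Casimir coefficients. -/

theorem FunRing.sum_apply {n : ℕ} {Ω : TopologicalSpace.Opens (Fin n → ℝ)} {ι : Type*}
    (s : Finset ι) (f : ι → FunRing Ω) (x : Ω) : (∑ i ∈ s, f i) x = ∑ i ∈ s, f i x :=
  Finset.sum_apply x s (fun i => (f i : Ω → ℝ))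

theorem IsSmooth.sum {n : ℕ} {Ω : TopologicalSpace.Opens (Fin n → ℝ)} {ι : Type*}
    {s : Finset ι} {f : ι → FunRing Ω} (h : ∀ i ∈ s, IsSmooth (f i)) : IsSmooth (∑ i ∈ s, f i) := by
  classical
  induction s using Finset.induction_on with
  | empty => exact IsSmooth.const 0
  | insert a s ha ih =>
    refine (congrArg (fun F : FunRing Ω => IsSmooth F) (Finset.sum_insert ha)).mpr ?_
    exact (h a (Finset.mem_insert_self a s)).add
      (ih fun i hi => h i (Finset.mem_insert_of_mem hi))

theorem zeroExt_of_mem {n : ℕ} {Ω : TopologicalSpace.Opens (Fin n → ℝ)} (f : Ω → ℝ)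
    {x : Fin n → ℝ} (h : x ∈ Ω) : zeroExt f x = f ⟨x, h⟩ :=
  zeroExt_apply f ⟨x, h⟩

/-- The function `ψ(x₁² + x₂² + x₃²)` on `Ω`. -/
def radial (ψ : ℝ → ℝ) : FunRing slΩ := fun x => ψ (normSq3 x.1)

theorem zeroExt_sum_casimir_mul_radial {ι : Type*} (s : Finset ι) (g : ι → casimirs slΛ)
    (ψ : ι → ℝ → ℝ) (p q : ℝ) {z : ℝ} (hz : 0 < z) :
    zeroExt (∑ i ∈ s, (g i).1 * radial (ψ i)) (param p q z)
      = ∑ i ∈ s, zeroExt (g i).1 (param 0 0 z) * ψ i (2 * p ^ 2 + z ^ 2) := by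
  have hm : param p q z ∈ slΩ := param_mem (Or.inr hz.ne')
  refine (zeroExt_of_mem _ hm).trans ((FunRing.sum_apply s _ _).trans
    (Finset.sum_congr rfl fun i _ => ?_))
  rw [← normSq3_param p q z]
  exact congrArg (· * _) ((zeroExt_of_mem _ hm).symm.trans (casimir_param (g i).2 hz p q 0 0))

/-- Casimir coefficients come out of the integral over a ruling, since they depend on z only; the
factor 2π is divided out. -/
theorem tendsto_sum_casimir_mul_leafIntegral {ι : Type*} {s : Finset ι} {g : ι → casimirs slΛ}
    {ψ : ι → ℝ → ℝ} (hψ : ∀ i, ContDiffOn ℝ ∞ (ψ i) (Set.Ioi 0))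
    (h : ∃ L : ℝ, Filter.Tendsto (fun z => ∫ t in (-1 : ℝ)..1,
      2 * Real.pi * zeroExt (∑ i ∈ s, (g i).1 * radial (ψ i)) (param t 0 z)) (𝓝[>] 0) (𝓝 L)) :
    ∃ L : ℝ, Filter.Tendsto
      (fun z => ∑ i ∈ s, zeroExt (g i).1 (param 0 0 z) * leafIntegral (ψ i) z) (𝓝[>] 0) (𝓝 L) := by
  obtain ⟨L, hL⟩ := h
  refine ⟨(2 * Real.pi)⁻¹ * L, (hL.const_mul (2 * Real.pi)⁻¹).congr' ?_⟩
  filter_upwards [self_mem_nhdsWithin] with z hz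
  simp only [zeroExt_sum_casimir_mul_radial s g ψ _ _ hz]
  rw [intervalIntegral.integral_const_mul, inv_mul_cancel_left₀ (by positivity),
    intervalIntegral.integral_finsetSum fun i _ =>
      ((continuous_leaf (hψ i).continuousOn hz).const_mul _).intervalIntegrable _ _]
  simp only [intervalIntegral.integral_const_mul, leafIntegral]

/-- An invariant analytic function is analytic at the origin too, so along (z, 0, 0) it has a zero
germ or finite vanishing order m at z = 0. A loss of z^m is harmless for exponential rates. -/
theorem casimir_coeff_exp_eq_zero {s : Finset (Set.Ioi (1 / 2 : ℝ))}
    {g : Set.Ioi (1 / 2 : ℝ) → casimirs slΛ} (hg : ∀ i ∈ s, g i ∈ invAnalytic)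
    (h : ∃ L : ℝ, Filter.Tendsto (fun z => ∑ i ∈ s, zeroExt (g i).1 (param 0 0 z)
      * leafIntegral (fun y => Real.exp (i / y) / y ^ 2) z) (𝓝[>] 0) (𝓝 L)) :
    ∀ i ∈ s, g i = 0 := by
  obtain ⟨L, hL⟩ := h
  have hpos : ∀ i : Set.Ioi (1 / 2 : ℝ), (0 : ℝ) < i := fun i => by
    have : (1 / 2 : ℝ) < i := i.2
    linarith
  have han : ∀ i ∈ s, ∃ f : ℝ → ℝ, AnalyticAt ℝ f 0 ∧
      (fun z => zeroExt (g i).1 (param 0 0 z)) =ᶠ[𝓝[>] 0] f := by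
    intro i hi
    obtain ⟨F, hF, -, hcF⟩ := hg i hi
    refine ⟨fun z => F (param 0 0 z), ?_, ?_⟩
    · have h1 : AnalyticAt ℝ (fun z : ℝ => param 0 0 z) 0 := by
        rw [analyticAt_pi_iff]
        intro j
        fin_cases j <;> simp [param]
        · exact analyticAt_id
        · exact analyticAt_const
        · exact analyticAt_const
      exact (hF _ (Set.mem_univ _)).comp h1
    · filter_upwards [self_mem_nhdsWithin] with z hz
      have hm : param 0 0 z ∈ slΩ := param_mem (Or.inr (ne_of_gt hz))
      exact (zeroExt_of_mem _ hm).trans (hcF ⟨_, hm⟩)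
  have hzero := eventuallyEq_zero_of_tendsto_sum (s := s)
    (c := fun i z => zeroExt (g i).1 (param 0 0 z))
    (F := fun i => leafIntegral fun y => Real.exp (i / y) / y ^ 2) ?_ ?_ hL
  · exact fun i hi => invAnalytic_eq_zero (hg i hi) (hzero i hi)
  · intro i hi
    obtain ⟨f, hf, hfe⟩ := han i hi
    exact ((hf.continuousAt.tendsto.mono_left nhdsWithin_le_nhds).isBigO_one ℝ).congr'
      hfe.symm Filter.EventuallyEq.rfl
  · intro i hi
    obtain ⟨f, hf, hfe⟩ := han i hi
    by_cases hf0 : ∀ᶠ z in 𝓝 0, f z = 0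
    · exact Or.inl (hfe.trans (Filter.Eventually.filter_mono nhdsWithin_le_nhds hf0))
    obtain ⟨m, u, hu, hu0, hfu⟩ := hf.exists_eventuallyEq_pow_smul_nonzero_iff.mpr hf0
    refine Or.inr ?_
    -- Near 0 the coefficient is z^m u(z) with |u(z)| > |u(0)|/2.
    have hO : (fun z => z ^ m * leafIntegral (fun y => Real.exp (i / y) / y ^ 2) z) =O[𝓝[>] 0]
        fun z => zeroExt (g i).1 (param 0 0 z)
          * leafIntegral (fun y => Real.exp (i / y) / y ^ 2) z := by
      refine Asymptotics.IsBigO.mul ?_ (Asymptotics.isBigO_refl _ _)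
      refine Asymptotics.IsBigO.of_bound (‖u 0‖ / 2)⁻¹ ?_
      have hnu : 0 < ‖u 0‖ := norm_pos_iff.mpr hu0
      have h1 : ∀ᶠ z in 𝓝 0, ‖u 0‖ / 2 < ‖u z‖ :=
        hu.continuousAt.norm.eventually_const_lt (by simpa using half_lt_self hnu)
      filter_upwards [hfe, h1.filter_mono nhdsWithin_le_nhds,
        hfu.filter_mono nhdsWithin_le_nhds] with z h2 h3 h4
      rw [h2, h4, norm_smul, inv_mul_eq_div, le_div_iff₀ (by positivity), sub_zero]
      exact mul_le_mul_of_nonneg_left h3.le (norm_nonneg _)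
    constructor
    · have h2 : (fun _ => (1 : ℝ)) =o[𝓝[>] 0]
          fun z => z ^ m * leafIntegral (fun y => Real.exp (i / y) / y ^ 2) z :=
        (Asymptotics.isLittleO_one_left_iff ℝ).mpr
          (tendsto_norm_atTop_atTop.comp
            (tendsto_pow_mul_leafIntegral_exp_atTop (hpos i) m))
      exact (Asymptotics.isLittleO_one_left_iff ℝ).mp (h2.trans_isBigO hO)
    · intro j _ hji
      exact (leafIntegral_exp_isLittleO (hpos j).le hji m).trans_isBigO hO

/-- Here the coefficients are constants: a coefficient of order z^m could offset the gap between two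
power rates. -/
theorem real_coeff_rpow_eq_zero {s : Finset (Set.Ioi (1 / 2 : ℝ))}
    {r : Set.Ioi (1 / 2 : ℝ) → ℝ}
    (h : ∃ L : ℝ, Filter.Tendsto (fun z => ∑ i ∈ s, r i
      * leafIntegral (fun y => 1 / y ^ (i : ℝ)) z) (𝓝[>] 0) (𝓝 L)) :
    ∀ i ∈ s, r i = 0 := by
  obtain ⟨L, hL⟩ := h
  have hzero := eventuallyEq_zero_of_tendsto_sum (s := s) (c := fun i _ => r i)
    (F := fun i => leafIntegral fun y => 1 / y ^ (i : ℝ)) ?_ ?_ hL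
  · intro i hi
    obtain ⟨z, hz⟩ := (hzero i hi).exists
    exact hz
  · exact fun i _ => Asymptotics.isBigO_const_const _ one_ne_zero _
  · intro i _
    by_cases hr : r i = 0
    · exact Or.inl (Filter.Eventually.of_forall fun _ => hr)
    refine Or.inr ⟨?_, fun j _ hji => ?_⟩
    · simp only [norm_mul]
      exact (tendsto_norm_atTop_atTop.comp
        (tendsto_leafIntegral_rpow_atTop i.2)).const_mul_atTop (norm_pos_iff.mpr hr)
    · have hj : (0 : ℝ) < j := by
        have : (1 / 2 : ℝ) < j := j.2
        linarith
      exact (leafIntegral_rpow_isLittleO hj hji i.2).trans_isBigO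
        ((Asymptotics.isBigO_refl _ _).const_mul_right hr)

/-! ### Classes in cohomology -/

theorem sum_smul_mem_of_sum_mkQ_eq_zero {R M ι : Type*} [CommRing R] [AddCommGroup M] [Module R M]
    {N Z : Submodule R M} {s : Finset ι} {g : ι → R} {Q : ι → M} (hQ : ∀ i, Q i ∈ Z)
    (h : ∑ i ∈ s, g i • (N.submoduleOf Z).mkQ ⟨Q i, hQ i⟩ = 0) : ∑ i ∈ s, g i • Q i ∈ N := by
  simp only [← map_smul, ← map_sum] at h
  rw [Submodule.mkQ_apply, Submodule.Quotient.mk_eq_zero] at h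
  have h1 : Z.subtype (∑ i ∈ s, g i • ⟨Q i, hQ i⟩) ∈ N := h
  rw [map_sum] at h1
  exact h1

section Classes

variable {n : ℕ} {Ω : TopologicalSpace.Opens (Fin n → ℝ)} (Λ : MVField Ω 2)
  (C : (k : ℕ) → Submodule (casimirs Λ) (MVField Ω k)) (k : ℕ)

/-- The class of a cocycle of the complex `(C, σ)`. -/
def cohomologyClass (Q : cocycles Λ C k) : Cohomology Λ C k :=
  ((coboundaries Λ C k).submoduleOf (cocycles Λ C k)).mkQ Q

variable {Λ C k}

theorem sum_smul_mem_coboundaries {ι : Type*} {s : Finset ι} {g : ι → casimirs Λ}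
    {f : ι → FunRing Ω} {E : MVField Ω k} (hQ : ∀ i, f i • E ∈ cocycles Λ C k)
    (h : ∑ i ∈ s, g i • cohomologyClass Λ C k ⟨f i • E, hQ i⟩ = 0) :
    (∑ i ∈ s, (g i).1 * f i) • E ∈ coboundaries Λ C k := by
  have h1 := sum_smul_mem_of_sum_mkQ_eq_zero hQ h
  refine (congrArg (· ∈ coboundaries Λ C k) ?_).mp h1
  rw [Finset.sum_smul]
  exact Finset.sum_congr rfl fun i _ => (mul_smul (g i).1 (f i) E).symm

end Classes

/-- Coboundaries `φ • E` with `φ` invariant along the circles `p, z = const` satisfy the limit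
obstruction. -/
def HasLimitObstruction (C : (k : ℕ) → Submodule (casimirs slΛ) (MVField slΩ k)) {k : ℕ}
    (E : MVField slΩ k) : Prop :=
  ∀ φ : FunRing slΩ, IsSmooth φ →
    (∀ p q q' z : ℝ, 0 < z → zeroExt φ (param p q z) = zeroExt φ (param p q' z)) →
    φ • E ∈ coboundaries slΛ C k →
    ∃ L : ℝ, Filter.Tendsto (fun z => ∫ s in (-1 : ℝ)..1, 2 * Real.pi * zeroExt φ (param s 0 z))
      (𝓝[>] 0) (𝓝 L)

section Independence

variable {C : (k : ℕ) → Submodule (casimirs slΛ) (MVField slΩ k)} {k : ℕ} {E : MVField slΩ k}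

theorem HasLimitObstruction.tendsto_sum (hE : HasLimitObstruction C E) {ι : Type*} {s : Finset ι}
    {g : ι → casimirs slΛ} {ψ : ι → ℝ → ℝ} (hψ : ∀ i, ContDiffOn ℝ ∞ (ψ i) (Set.Ioi 0))
    (hQ : ∀ i, radial (ψ i) • E ∈ cocycles slΛ C k)
    (h : ∑ i ∈ s, g i • cohomologyClass slΛ C k ⟨radial (ψ i) • E, hQ i⟩ = 0) :
    ∃ L : ℝ, Filter.Tendsto
      (fun z => ∑ i ∈ s, zeroExt (g i).1 (param 0 0 z) * leafIntegral (ψ i) z) (𝓝[>] 0) (𝓝 L) := by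
  refine tendsto_sum_casimir_mul_leafIntegral hψ (hE _ ?_ ?_ (sum_smul_mem_coboundaries hQ h))
  · exact IsSmooth.sum fun i _ => (g i).2.1.mul (isSmooth_comp_normSq3 (hψ i))
  · intro p q q' z hz
    simp only [zeroExt_sum_casimir_mul_radial s g ψ _ _ hz]

theorem invPoly_mem_invAnalytic {c : casimirs slΛ} (hc : c ∈ invPoly) : c ∈ invAnalytic := by
  obtain ⟨p, hp, h⟩ := hc
  exact ⟨fun μ => MvPolynomial.eval μ p, AnalyticOnNhd.eval_mvPolynomial p, hp, h⟩

/-- Needed for injectivity of ℝ → I(Ω) and for excluding infinite independent families in finite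
modules over the coefficient rings. -/
instance : Nontrivial (casimirs slΛ) := by
  refine ⟨0, 1, fun h => ?_⟩
  have h1 := congrArg (fun c : casimirs slΛ => c.1 ⟨param 1 0 0, param_mem (Or.inl one_ne_zero)⟩) h
  exact zero_ne_one (α := ℝ) h1

theorem linearIndependent_exp (hE : HasLimitObstruction C E)
    (hQ : ∀ α : Set.Ioi (1 / 2 : ℝ),
      radial (fun y => Real.exp (α / y) / y ^ 2) • E ∈ cocycles slΛ C k) :
    LinearIndependent ℝ (fun α => cohomologyClass slΛ C k ⟨_, hQ α⟩) ∧
    LinearIndependent invPoly (fun α => cohomologyClass slΛ C k ⟨_, hQ α⟩) ∧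
    LinearIndependent invAnalytic (fun α => cohomologyClass slΛ C k ⟨_, hQ α⟩) := by
  -- All three scalar rings act through analytic invariant Casimirs, so one statement covers them.
  have key : ∀ (s : Finset (Set.Ioi (1 / 2 : ℝ))) (g : Set.Ioi (1 / 2 : ℝ) → casimirs slΛ),
      (∀ i ∈ s, g i ∈ invAnalytic) →
      ∑ i ∈ s, g i • cohomologyClass slΛ C k ⟨_, hQ i⟩ = 0 → ∀ i ∈ s, g i = 0 :=
    fun s g hg h => casimir_coeff_exp_eq_zero hg
      (hE.tendsto_sum (fun i => contDiffOn_exp_div i) hQ h)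
  refine ⟨?_, ?_, ?_⟩ <;> rw [linearIndependent_iff'] <;> intro s g h i hi
  · have := key s (fun i => algebraMap ℝ _ (g i)) (fun i _ => invAnalytic.algebraMap_mem _) h i hi
    exact (map_eq_zero_iff _ (algebraMap ℝ (casimirs slΛ)).injective).mp this
  · exact Subtype.ext (key s (fun i => (g i).1) (fun i _ => invPoly_mem_invAnalytic (g i).2) h i hi)
  · exact Subtype.ext (key s (fun i => (g i).1) (fun i _ => (g i).2) h i hi)

theorem linearIndependent_rpow (hE : HasLimitObstruction C E)
    (hQ : ∀ α : Set.Ioi (1 / 2 : ℝ),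
      radial (fun y => 1 / y ^ (α : ℝ)) • E ∈ cocycles slΛ C k) :
    LinearIndependent ℝ (fun α => cohomologyClass slΛ C k ⟨_, hQ α⟩) := by
  rw [linearIndependent_iff']
  intro s g h
  refine real_coeff_rpow_eq_zero ?_
  obtain ⟨L, hL⟩ := hE.tendsto_sum (g := fun i => algebraMap ℝ _ (g i))
    (fun i => contDiffOn_rpow_inv i) hQ h
  refine ⟨L, hL.congr' ?_⟩
  filter_upwards [self_mem_nhdsWithin] with z hz
  refine Finset.sum_congr rfl fun i _ => ?_
  exact congrArg (· * _) (zeroExt_of_mem _ (param_mem (Or.inr (ne_of_gt hz))))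

theorem isInfiniteDim_of_exp (hE : HasLimitObstruction C E)
    (hQ : ∀ α : Set.Ioi (1 / 2 : ℝ),
      radial (fun y => Real.exp (α / y) / y ^ 2) • E ∈ cocycles slΛ C k) :
    IsInfiniteDim (Cohomology slΛ C k) := by
  obtain ⟨h1, h2, h3⟩ := linearIndependent_exp hE hQ
  have : Infinite (Set.Ioi (1 / 2 : ℝ)) := (Set.Ioi_infinite _).to_subtype
  exact ⟨fun _ => Module.Finite.not_linearIndependent_of_infinite _ h1,
    fun _ => Module.Finite.not_linearIndependent_of_infinite _ h2,
    fun _ => Module.Finite.not_linearIndependent_of_infinite _ h3⟩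

end Independence

theorem smul_aH3_one (φ : FunRing slΩ) : (φ • aH3 1 : MVField slΩ 1) = aH3 φ :=
  funext fun x => congrArg (φ x • ·) (one_smul ℝ (ham slΛ (fun y => y.1 2) x))

theorem hasLimitObstruction_aH3 (C : (k : ℕ) → Submodule (casimirs slΛ) (MVField slΩ k)) :
    HasLimitObstruction C (aH3 1) := by
  rintro φ hφ - ⟨-, Q, -, hQ, hσ⟩
  have h1 : ofFun (fun x => Q x ![]) = Q := by
    funext x
    refine AlternatingMap.ext fun ξ => ?_
    rw [Subsingleton.elim ξ ![]]
    rfl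
  rw [smul_aH3_one, ← h1] at hσ
  obtain ⟨L, hL⟩ := limit_obstruction_degree_one (hQ ![]) hφ hσ 0
  refine ⟨2 * Real.pi * L, (hL.const_mul (2 * Real.pi)).congr fun z => ?_⟩
  rw [intervalIntegral.integral_const_mul]

theorem hasLimitObstruction_slΛ (C : (k : ℕ) → Submodule (casimirs slΛ) (MVField slΩ k)) :
    HasLimitObstruction C slΛ := by
  rintro φ hφ hinv ⟨-, B, -, hB, hσ⟩
  exact limit_obstruction_degree_two hφ hinv hB hσ 0

theorem hasLimitObstruction_mulVol (C : (k : ℕ) → Submodule (casimirs slΛ) (MVField slΩ k)) :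
    HasLimitObstruction C (fun _ => Matrix.detRowAlternating : MVField slΩ 3) := by
  rintro φ hφ hinv ⟨-, P, -, hP, hσ⟩
  exact limit_obstruction_degree_three hφ hinv hP hσ 0

/-! ### Cocycles -/

theorem aH3_radial_mem_sigmaKer {ψ : ℝ → ℝ} (hψ : ContDiffOn ℝ ∞ ψ (Set.Ioi 0)) :
    aH3 (radial ψ) ∈ sigmaKer slΛ 1 :=
  ⟨isSmoothField_aH3 (isSmooth_comp_normSq3 hψ),
    isSigma_aH3 (isSmooth_comp_normSq3 hψ) (slΛ_dCov_comp_normSq3 hψ)⟩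

theorem mulΛ_mem_sigmaKer {φ : slΩ → ℝ} (hφ : IsSmooth φ) : mulΛ φ ∈ sigmaKer slΛ 2 :=
  ⟨isSmoothField_mulΛ hφ, isSigma_mulΛ hφ⟩

theorem mulVol_mem_cocycles {φ : slΩ → ℝ} (hφ : IsSmooth φ) :
    mulVol φ ∈ cocycles slΛ (fields slΛ) 3 :=
  ⟨isSmoothField_mulVol hφ, isSmoothField_mulVol hφ, isSigma_mulVol hφ⟩

theorem aH3_radial_mem_cocycles {ψ : ℝ → ℝ} (hψ : ContDiffOn ℝ ∞ ψ (Set.Ioi 0)) :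
    aH3 (radial ψ) ∈ cocycles slΛ (tangentialFields slΛ) 1 :=
  ⟨⟨(aH3_radial_mem_sigmaKer hψ).1, isTangential_aH3 _⟩, aH3_radial_mem_sigmaKer hψ⟩

theorem mulΛ_mem_cocycles {φ : slΩ → ℝ} (hφ : IsSmooth φ) :
    mulΛ φ ∈ cocycles slΛ (tangentialFields slΛ) 2 :=
  ⟨⟨isSmoothField_mulΛ hφ, isTangential_mulΛ _⟩, mulΛ_mem_sigmaKer hφ⟩

/-! ### Degree zero and degrees above two -/

/-- A Casimir function as a tangential cocycle of degree `0`. -/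
def casimirCocycle (Λ : MVField slΩ 2) :
    casimirs Λ →ₗ[casimirs Λ] cocycles Λ (tangentialFields Λ) 0 where
  toFun c := ⟨ofFun c.1, ⟨fun _ => c.2.1, fun _ _ h => h.elim fun i => i.elim0⟩, fun _ => c.2.1,
    fun x ξ => by
      rw [sigma_degree_zero]
      exact (sharpDeriv_casimir c.2 (ξ 0) x).symm⟩
  map_add' _ _ := rfl
  map_smul' _ _ := rfl

theorem casimirCocycle_bijective (Λ : MVField slΩ 2) : Function.Bijective (casimirCocycle Λ) := by
  constructor
  · intro c c' h
    refine Subtype.ext (funext fun x => ?_)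
    exact congrArg (fun Q : cocycles Λ (tangentialFields Λ) 0 => Q.1 x ![]) h
  · rintro ⟨Q, hQ, hQ', hσ⟩
    have hc : (fun x => Q x ![] : FunRing slΩ) ∈ casimirs Λ := by
      refine ⟨hQ' ![], fun x => AlternatingMap.ext fun ξ => ?_⟩
      have h := hσ x ![ξ 0]
      rw [sigma_degree_zero] at h
      rw [vec_one_eq ξ]
      change Λ x ![dCov (fun x => Q x ![]) x, ξ 0] = 0
      rw [lambda_skew]
      exact neg_eq_zero.mpr h.symm
    refine ⟨⟨_, hc⟩, Subtype.ext (funext fun x => AlternatingMap.ext fun ξ => ?_)⟩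
    rw [Subsingleton.elim ξ ![]]
    rfl

theorem nonempty_HTan_zero_equiv (Λ : MVField slΩ 2) :
    Nonempty (HTan Λ 0 ≃ₗ[casimirs Λ] casimirs Λ) := by
  have hbot : (coboundaries Λ (tangentialFields Λ) 0).submoduleOf
      (cocycles Λ (tangentialFields Λ) 0) = ⊥ := by
    refine (Submodule.eq_bot_iff _).mpr fun Q hQ => ?_
    exact Subtype.ext hQ
  exact ⟨(Submodule.quotEquivOfEqBot _ hbot).trans
    (LinearEquiv.ofBijective _ (casimirCocycle_bijective Λ)).symm⟩

/-- Half the differential of x₁² + x₂² - x₃² is a nonzero covector v annihilating the leaf. In a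
basis of the three-dimensional covector space containing v, more than two distinct basis vectors
must include v. -/
theorem tangential_eq_zero {k : ℕ} (hk : 2 < k) {Q : MVField slΩ k} (hQ : IsTangential slΛ Q) :
    Q = 0 := by
  funext x
  set v : Fin 3 → ℝ := ![x.1 0, x.1 1, -x.1 2] with hv
  have hann : ∀ η, slΛ x ![η, v] = 0 := by
    intro η
    simp [slΛ_apply, hv]
    ring
  have hv0 : v ≠ 0 := by
    intro h0
    have h1 := normSq3_pos x.2
    have e0 := congrFun h0 0
    have e1 := congrFun h0 1
    have e2 := congrFun h0 2
    simp [hv] at e0 e1 e2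
    simp [normSq3, e0, e1, e2] at h1
  have hli : LinearIndepOn ℝ id ({v} : Set (Fin 3 → ℝ)) := LinearIndepOn.singleton hv0
  set b := Module.Basis.extend hli with hb
  have hvmem : v ∈ hli.extend (Set.subset_univ _) := hli.subset_extend _ rfl
  have : Fintype (hli.extend (Set.subset_univ _)) := FiniteDimensional.fintypeBasisIndex b
  have hcard : Fintype.card (hli.extend (Set.subset_univ _)) = 3 := by
    rw [← Module.finrank_eq_card_basis b]
    simp
  refine Module.Basis.ext_alternating b fun w hw => ?_
  have hle := Fintype.card_le_of_injective w hw
  rw [Fintype.card_fin, hcard] at hle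
  have hbij : Function.Bijective w :=
    (Fintype.bijective_iff_injective_and_card w).mpr ⟨hw, by rw [Fintype.card_fin, hcard]; omega⟩
  obtain ⟨i, hi⟩ := hbij.2 ⟨v, hvmem⟩
  refine hQ x _ ⟨i, fun η => ?_⟩
  rw [hi, hb, Module.Basis.extend_apply_self]
  exact hann η

theorem subsingleton_HTan {k : ℕ} (hk : 2 < k) : Subsingleton (HTan slΛ k) := by
  have : Subsingleton (cocycles slΛ (tangentialFields slΛ) k) :=
    ⟨fun Q Q' => Subtype.ext ((tangential_eq_zero hk Q.2.1.2).trans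
      (tangential_eq_zero hk Q'.2.1.2).symm)⟩
  exact (Submodule.mkQ_surjective _).subsingleton

end PoissonTP

end

open PoissonTP in
theorem mainTheorem12 :
    -- H⁰_tan = I(Ω), and Hᵏ_tan = 0 for k > 2
    Nonempty (HTan slΛ 0 ≃ₗ[casimirs slΛ] casimirs slΛ) ∧
    (∀ k : ℕ, 2 < k → Subsingleton (HTan slΛ k)) ∧
    -- limit obstruction in degree 1
    (∀ a f : slΩ → ℝ, IsSmooth a → IsSmooth f → IsSigma slΛ (ofFun f) (aH3 a) →
      ∀ q : ℝ, ∃ L : ℝ, Filter.Tendsto (fun z => ∫ s in (-1 : ℝ)..1, zeroExt a (param s q z))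
        (𝓝[>] 0) (𝓝 L)) ∧
    -- limit obstruction in degree 2
    (∀ φ : slΩ → ℝ, IsSmooth φ →
      (∀ p q q' z : ℝ, 0 < z → zeroExt φ (param p q z) = zeroExt φ (param p q' z)) →
      (∃ B ∈ tangentialFields slΛ 1, IsSigma slΛ B (mulΛ φ)) →
      ∀ q : ℝ, ∃ L : ℝ, Filter.Tendsto
        (fun z => ∫ s in (-1 : ℝ)..1, 2 * Real.pi * zeroExt φ (param s q z)) (𝓝[>] 0) (𝓝 L)) ∧
    -- explicit families in degree 1
    (∃ hT : ∀ α : Set.Ioi (1 / 2 : ℝ), aH3 (tHat α) ∈ cocycles slΛ (tangentialFields slΛ) 1,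
      LinearIndependent ℝ (fun α : Set.Ioi (1 / 2 : ℝ) =>
        tanClass slΛ 1 ⟨aH3 (tHat α), hT α⟩)) ∧
    (∃ hK : ∀ α : Set.Ioi (1 / 2 : ℝ), aH3 (kHat α) ∈ cocycles slΛ (tangentialFields slΛ) 1,
      LinearIndependent ℝ (fun α : Set.Ioi (1 / 2 : ℝ) =>
        tanClass slΛ 1 ⟨aH3 (kHat α), hK α⟩) ∧
      LinearIndependent invPoly (fun α : Set.Ioi (1 / 2 : ℝ) =>
        tanClass slΛ 1 ⟨aH3 (kHat α), hK α⟩) ∧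
      LinearIndependent invAnalytic (fun α : Set.Ioi (1 / 2 : ℝ) =>
        tanClass slΛ 1 ⟨aH3 (kHat α), hK α⟩)) ∧
    -- explicit families in degree 2
    (∃ hT : ∀ α : Set.Ioi (1 / 2 : ℝ), mulΛ (tHat α) ∈ cocycles slΛ (tangentialFields slΛ) 2,
      LinearIndependent ℝ (fun α : Set.Ioi (1 / 2 : ℝ) =>
        tanClass slΛ 2 ⟨mulΛ (tHat α), hT α⟩)) ∧
    (∃ hK : ∀ α : Set.Ioi (1 / 2 : ℝ), mulΛ (kHat α) ∈ cocycles slΛ (tangentialFields slΛ) 2,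
      LinearIndependent ℝ (fun α : Set.Ioi (1 / 2 : ℝ) =>
        tanClass slΛ 2 ⟨mulΛ (kHat α), hK α⟩) ∧
      LinearIndependent invPoly (fun α : Set.Ioi (1 / 2 : ℝ) =>
        tanClass slΛ 2 ⟨mulΛ (kHat α), hK α⟩) ∧
      LinearIndependent invAnalytic (fun α : Set.Ioi (1 / 2 : ℝ) =>
        tanClass slΛ 2 ⟨mulΛ (kHat α), hK α⟩)) ∧
    -- infinite-dimensionality
    IsInfiniteDim (HTan slΛ 1) ∧ IsInfiniteDim (HTan slΛ 2) ∧
    (∀ k : ℕ, 1 ≤ k → k ≤ 3 → IsInfiniteDim (HP slΛ k)) := by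
  have hE1 := hasLimitObstruction_aH3
  have hE2 := hasLimitObstruction_slΛ
  have t1 : ∀ {ψ : ℝ → ℝ}, ContDiffOn ℝ ∞ ψ (Set.Ioi 0) →
      radial ψ • aH3 1 ∈ cocycles slΛ (tangentialFields slΛ) 1 := fun hψ => by
    rw [smul_aH3_one]
    exact aH3_radial_mem_cocycles hψ
  have t2 : ∀ {ψ : ℝ → ℝ}, ContDiffOn ℝ ∞ ψ (Set.Ioi 0) →
      radial ψ • slΛ ∈ cocycles slΛ (tangentialFields slΛ) 2 := fun hψ =>
    mulΛ_mem_cocycles (isSmooth_comp_normSq3 hψ)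
  -- The forms a H_{x₃} and a • (1 · H_{x₃}) agree only after `one_smul`, so the classes have to be
  -- identified; in degree 2 the two forms coincide by definition.
  have c1 : ∀ (ψ : ℝ → ℝ) (h : radial ψ • aH3 1 ∈ cocycles slΛ (tangentialFields slΛ) 1)
      (h' : aH3 (radial ψ) ∈ cocycles slΛ (tangentialFields slΛ) 1),
      tanClass slΛ 1 ⟨_, h'⟩ = cohomologyClass slΛ (tangentialFields slΛ) 1 ⟨_, h⟩ :=
    fun ψ h h' => congrArg (tanClass slΛ 1) (Subtype.ext (smul_aH3_one (radial ψ)).symm)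
  refine ⟨nonempty_HTan_zero_equiv slΛ, fun k hk => subsingleton_HTan hk,
    fun a f ha hf h q => limit_obstruction_degree_one hf ha h q,
    fun φ hφ hinv ⟨B, hB, h⟩ q => limit_obstruction_degree_two hφ hinv hB.1 h q,
    ⟨fun α => aH3_radial_mem_cocycles (contDiffOn_rpow_inv α), ?_⟩,
    ⟨fun α => aH3_radial_mem_cocycles (contDiffOn_exp_div α), ?_⟩,
    ⟨fun α => t2 (contDiffOn_rpow_inv α),
      linearIndependent_rpow (hE2 _) fun α => t2 (contDiffOn_rpow_inv α)⟩,
    ⟨fun α => t2 (contDiffOn_exp_div α),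
      linearIndependent_exp (hE2 _) fun α => t2 (contDiffOn_exp_div α)⟩,
    isInfiniteDim_of_exp (hE1 _) fun α => t1 (contDiffOn_exp_div α),
    isInfiniteDim_of_exp (hE2 _) fun α => t2 (contDiffOn_exp_div α), ?_⟩
  · have := linearIndependent_rpow (hE1 (tangentialFields slΛ))
      fun α => t1 (contDiffOn_rpow_inv α)
    simpa only [← c1 _ _ (aH3_radial_mem_cocycles (contDiffOn_rpow_inv _))] using! this
  · have := linearIndependent_exp (hE1 (tangentialFields slΛ))
      fun α => t1 (contDiffOn_exp_div α)
    simpa only [← c1 _ _ (aH3_radial_mem_cocycles (contDiffOn_exp_div _))] using! this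
  · intro k hk1 hk3
    interval_cases k
    -- Tangential cocycles are cocycles of the full complex, and the obstruction also excludes
    -- non-tangential primitives, so the same families work in degrees 1 and 2.
    · exact isInfiniteDim_of_exp (hE1 _) fun α =>
        ⟨(t1 (contDiffOn_exp_div α)).1.1, (t1 (contDiffOn_exp_div α)).2⟩
    · exact isInfiniteDim_of_exp (hE2 _) fun α =>
        ⟨(t2 (contDiffOn_exp_div α)).1.1, (t2 (contDiffOn_exp_div α)).2⟩
    · exact isInfiniteDim_of_exp (hasLimitObstruction_mulVol _) fun α =>
        mulVol_mem_cocycles (isSmooth_comp_normSq3 (contDiffOn_exp_div α))
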